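/- Work in $\mathsf{ZFC}$. For a regular cardinal $\theta$, $H_\theta$ is the set of all sets whose transitive closure has size less than $\theta$, and $\theta\gg\omega_2$ means $\mathscr P(\mathscr P(\omega_2))\in H_\theta$. For a countable $M\prec H_\theta$ (elementary in the language $\{\in\}$) and a set $x\in\bigcup M$ put $\mathrm{Hull}(M,x)=\{f(x) : f\in M \text{ a function},\ x\in\mathrm{dom}(f)\}$, and write $x\parallel_{\omega_1}M$ if $\mathrm{Hull}(M,x)\cap\omega_1=M\cap\omega_1$. Let $\mathsf{SCC}^{\mathrm{cof}}$ (the cof-Strong Chang's Conjecture) be the statement: for every regular cardinal $\theta\gg\omega_2$ and every countable $M\prec H_\theta$ there are cofinally many $\xi\in\omega_2$ such that $\xi\parallel_{\omega_1}M$. For a countable $M\prec H_\theta$ and $X\in M$, the $X$-capturing game $\mathbf G^{cap}_M(X)$ is the following game of length $\omega$ between players $P1$ and $P2$. Put $M_0=M$. In round $n$, $P1$ plays some $x_n\in X$ (not necessarily in $M_n$); then $P2$ has to play a function $f_n:\omega_1\to X$ with $f_n(M_n\cap\omega_1)=x_n$ and $f_n\parallel_{\omega_1}M_n$; and $M_{n+1}=\mathrm{Hull}(M_n,f_n)$.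 The first player to break the rules loses; if nobody breaks the rules, $P2$ wins. Then the following two statements are equivalent: (a) $\mathsf{SCC}^{\mathrm{cof}}$; (b) for every regular cardinal $\theta\gg\omega_2$ and every countable $M\prec H_\theta$, player $P2$ has a winning strategy in the $\omega_2$-capturing game $\mathbf G^{cap}_M(\omega_2)$ for $M$. -/

import Mathlib

open FirstOrder

universe u

namespace CapturingGame

/-- The only symbol of the language of set theory: a binary relation symbol for membership. -/
inductive MemRel : ℕ → Type
  | mem : MemRel 2

/-- The first-order language of set theory. -/
def setLang : FirstOrder.Language.{0, 0} := ⟨fun _ => Empty, MemRel⟩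

/-- Every class of sets is an `∈`-structure. -/
instance setStructure (A : Set ZFSet.{u}) : setLang.Structure A where
  funMap := fun f => f.elim
  RelMap | .mem => fun v => (v 0 : ZFSet.{u}) ∈ (v 1 : ZFSet.{u})

/-- `M ≺ A`: the class `M` is contained in `A`, and the inclusion is an elementary embedding of
the `∈`-structure `M` into the `∈`-structure `A`. -/
def IsElementarySubmodel (M A : Set ZFSet.{u}) : Prop :=
  ∃ e : M ↪ₑ[setLang] A, ∀ x : M, (e x : ZFSet.{u}) = x

/-- The ordinal `ω₁`, as a set. -/
noncomputable def omega1 : ZFSet.{u} := (Ordinal.omega 1 : Ordinal.{u}).toZFSet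

/-- The ordinal `ω₂`, as a set. -/
noncomputable def omega2 : ZFSet.{u} := (Ordinal.omega 2 : Ordinal.{u}).toZFSet

/-- `H_θ`: the sets whose transitive closure has cardinality less than `θ`, that is, the sets which
are included in a transitive set of cardinality less than `θ`. -/
def H (θ : Cardinal.{u}) : Set ZFSet.{u} :=
  {x | ∃ t : ZFSet.{u}, t.IsTransitive ∧ x ⊆ t ∧ t.card < θ}

/-- `X ≪ θ`: the double power set of `X` belongs to `H_θ`. -/
def MuchLess (X : ZFSet.{u}) (θ : Cardinal.{u}) : Prop :=
  X.powerset.powerset ∈ H θ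

/-- The set `f` is a function (on some set). -/
def IsFunction (f : ZFSet.{u}) : Prop :=
  ∃ d r : ZFSet.{u}, ZFSet.IsFunc d r f

/-- `Hull(M, x) = {f(x) : f ∈ M a function, x ∈ dom(f)}`. -/
def Hull (M : Set ZFSet.{u}) (x : ZFSet.{u}) : Set ZFSet.{u} :=
  {y | ∃ f ∈ M, IsFunction f ∧ ZFSet.pair x y ∈ f}

/-- `δ(M) = M ∩ ω₁`, as a set. -/
noncomputable def delta (M : Set ZFSet.{u}) : ZFSet.{u} :=
  ZFSet.sep (fun α => α ∈ M) omega1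

/-- `x ∥_{ω₁} M`: the hull `Hull(M, x)` has the same countable ordinals as `M`. -/
def Parallel (x : ZFSet.{u}) (M : Set ZFSet.{u}) : Prop :=
  delta (Hull M x) = delta M

/-- The cof-Strong Chang's Conjecture. -/
def SCCcof : Prop :=
  ∀ θ : Cardinal.{u}, θ.IsRegular → MuchLess omega2 θ →
    ∀ M : Set ZFSet.{u}, M.Countable → IsElementarySubmodel M (H θ) →
      ∀ η ∈ omega2.{u}, ∃ ξ ∈ omega2.{u}, η ⊆ ξ ∧ Parallel ξ M

/-- The models `M₀ = M`, `M_{n+1} = Hull(M_n, f_n)` built during a play in which the second player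
plays `f₀, f₁, …`. -/
def model (M : Set ZFSet.{u}) (f : ℕ → ZFSet.{u}) : ℕ → Set ZFSet.{u}
  | 0 => M
  | n + 1 => Hull (model M f n) (f n)

/-- In the `X`-capturing game for `M`, the answer `f_n` in round `n` to the challenge `x_n` obeys
the rules: `f_n : ω₁ → X`, `f_n(M_n ∩ ω₁) = x_n` and `f_n ∥_{ω₁} M_n`. -/
def ObeysP2 (M : Set ZFSet.{u}) (X : ZFSet.{u}) (x f : ℕ → ZFSet.{u}) (n : ℕ) : Prop :=
  ZFSet.IsFunc omega1 X (f n) ∧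
    ZFSet.pair (delta (model M f n)) (x n) ∈ f n ∧
    Parallel (f n) (model M f n)

/-- The second player wins the play `x₀, f₀, x₁, f₁, …` of the `X`-capturing game for `M`: if he
breaks the rules in some round, then the first player broke them (by playing some `x_m ∉ X`)
before that. -/
def WinsP2 (M : Set ZFSet.{u}) (X : ZFSet.{u}) (x f : ℕ → ZFSet.{u}) : Prop :=
  ∀ n, ¬ ObeysP2 M X x f n → ∃ m ≤ n, x m ∉ X

/-- A strategy of the second player: it gives his next move from the previous rounds
`(x₀, f₀), …, (x_{n-1}, f_{n-1})` and the challenge `x_n`. -/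
abbrev StrategyP2 : Type (u + 1) :=
  List (ZFSet.{u} × ZFSet.{u}) → ZFSet.{u} → ZFSet.{u}

/-- In the play `x₀, f₀, x₁, f₁, …` the second player follows the strategy `σ`. -/
def Follows (σ : StrategyP2.{u}) (x f : ℕ → ZFSet.{u}) : Prop :=
  ∀ n, f n = σ (List.ofFn fun i : Fin n => (x i, f i)) (x n)

/-- The second player has a winning strategy in the `X`-capturing game for `M`. -/
def P2HasWinningStrategy (M : Set ZFSet.{u}) (X : ZFSet.{u}) : Prop :=
  ∃ σ : StrategyP2.{u}, ∀ x f : ℕ → ZFSet.{u}, Follows σ x f → WinsP2 M X x f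

end CapturingGame

/-!
The two statements are compared through the countable models `N ≺ H_θ` which extend a given `M` and
have the same countable ordinals, `N ∩ ω₁ = M ∩ ω₁ = δ` (`IsDeltaExtension`). If `X ∈ M` and
`x ∈ X`, then the hull `Hull(M, x)` is again an elementary submodel (`hull_isElementarySubmodel`,
with Skolem functions on `X` provided by replacement in `H_θ`), so `x ∥ M` holds if and only if `x`
belongs to such an extension (`parallel_of_mem`). Such extensions are closed under unions of
`ω`-chains.

From a winning strategy to `SCC^cof`: let the first player play `η < ω₂`, and let `f` be the
answer. The range of `f` is bounded in `ω₂`, so by elementarity `Hull(M, f)` contains a bound `ξ`,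
and `η = f(δ) < ξ`; since `Hull(M, f)` has no new countable ordinals, `ξ ∥ M`.

From `SCC^cof` to a winning strategy: as all the models of a play are such extensions, it suffices
to answer one challenge `x < ω₂`, that is, to find an extension `N` of `M` and `f : ω₁ → ω₂` in `N`
with `f(δ) = x` (`SCCcofFor.exists_answer`). By `SCC^cof` there is an extension with an ordinal
`ξ₀ > x` in `ω₂`, and `x = E_{ξ₀}(α)` for some `α < ω₁`, where `E ∈ M` is a family of surjections
`E_ξ : ω₁ → ξ`, for `0 < ξ < ω₂`. It remains to capture the countable ordinal `α`. For this, fix in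
`M` a family of functions `c_ξ : ω₁ → ω₁`, `ξ < ω₂`, similar to the canonical functions:
`c_ξ(β) > c_η(β)` whenever `η < ξ` is in `E_ξ[β]`. If `ξ ∈ N`, then `E_ξ[δ]` contains `N ∩ ξ`.
Hence adding, again and again, ordinals `ξ` above `N ∩ ω₂` to the model makes `c_ξ(δ)` as large a
countable ordinal as desired (`SCCcofFor.exists_large_rank`). Once `α < c_ξ(δ)`, we have
`α = D(c_ξ(δ), n)` for some `n < ω`, where `D ∈ M` is a family of surjections from `ω` to the
countable ordinals, and the function `f(β) = E_{ξ₀}(D(c_ξ(β), n))` is in the model and satisfies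
`f(δ) = x`.

Elementarity is handled semantically. `DefP A M` is the class of predicates on assignments `ℕ → A`
which are defined by formulas with parameters in `M`; the Tarski–Vaught test
`isElementarySubmodel_iff` translates between it and elementary embeddings, and the rules of the
calculus of `DefP` replace the writing of formulas.
-/

namespace CapturingGame

/-! ### Definable predicates and the Tarski–Vaught test -/

/-- The sequence `a, v 0, v 1, …`. -/
def scons (a : ZFSet.{u}) (v : ℕ → ZFSet.{u}) : ℕ → ZFSet.{u}
  | 0 => a
  | n + 1 => v n

/-- The terms of the language of set theory with parameters in `M`: variables and parameters,
as functions of the assignment of the variables. -/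
def IsTerm (M : Set ZFSet.{u}) (F : (ℕ → ZFSet.{u}) → ZFSet.{u}) : Prop :=
  (∃ i, F = fun v => v i) ∨ ∃ a ∈ M, F = fun _ => a

/-- `DefP A M P`: on assignments with values in `A`, the predicate `P` is defined by a first-order
formula with parameters in `M`, in which all quantifiers range over `A`. Variables are de Bruijn
indices. The clause `congr` says that only the assignments with values in `A` matter. -/
inductive DefP (A M : Set ZFSet.{u}) : ((ℕ → ZFSet.{u}) → Prop) → Prop
  | mem {F G} : IsTerm M F → IsTerm M G → DefP A M (fun v => F v ∈ G v)
  | eq {F G} : IsTerm M F → IsTerm M G → DefP A M (fun v => F v = G v)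
  | imp {P Q} : DefP A M P → DefP A M Q → DefP A M (fun v => P v → Q v)
  | false : DefP A M (fun _ => False)
  | all {P} : DefP A M P → DefP A M (fun v => ∀ y ∈ A, P (scons y v))
  | congr {P Q} : DefP A M P → (∀ v, (∀ n, v n ∈ A) → (Q v ↔ P v)) → DefP A M Q

variable {A M N : Set ZFSet.{u}}

theorem scons_mem {a : ZFSet.{u}} {v : ℕ → ZFSet.{u}} (ha : a ∈ A) (hv : ∀ n, v n ∈ A) :
    ∀ n, scons a v n ∈ A
  | 0 => ha
  | n + 1 => hv n

/-- Every definable predicate is given by a formula, with the parameters as free variables. -/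
theorem DefP.exists_formula (hMA : M ⊆ A) {P : (ℕ → ZFSet.{u}) → Prop} (hP : DefP A M P) :
    ∃ φ : setLang.Formula (ℕ ⊕ M), ∀ v : ℕ → A,
      φ.Realize (Sum.elim v (Set.inclusion hMA)) ↔ P (fun n => v n) := by
  have hterm : ∀ F : (ℕ → ZFSet.{u}) → ZFSet.{u}, IsTerm M F → ∃ i : ℕ ⊕ M,
      ∀ v : ℕ → A, ((Sum.elim v (Set.inclusion hMA) i : A) : ZFSet.{u}) = F (fun n => v n) := by
    rintro F (⟨i, rfl⟩ | ⟨a, ha, rfl⟩)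
    · exact ⟨Sum.inl i, fun v => rfl⟩
    · exact ⟨Sum.inr ⟨a, ha⟩, fun v => rfl⟩
  induction hP with
  | @mem F G hF hG =>
    obtain ⟨i, hi⟩ := hterm F hF
    obtain ⟨j, hj⟩ := hterm G hG
    refine ⟨Language.Relations.formula (L := setLang) (show setLang.Relations 2 from MemRel.mem)
      ![Language.Term.var i, Language.Term.var j], fun v => ?_⟩
    refine Iff.trans Language.Formula.realize_rel ?_
    beta_reduce
    rw [← hi, ← hj]
    exact Iff.rfl
  | @eq F G hF hG =>
    obtain ⟨i, hi⟩ := hterm F hF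
    obtain ⟨j, hj⟩ := hterm G hG
    refine ⟨Language.Term.equal (Language.Term.var i) (Language.Term.var j), fun v => ?_⟩
    refine Language.Formula.realize_equal.trans ?_
    beta_reduce
    rw [← hi, ← hj]
    exact Subtype.ext_iff
  | imp _ _ h1 h2 =>
    obtain ⟨φ, hφ⟩ := h1
    obtain ⟨ψ, hψ⟩ := h2
    refine ⟨φ.imp ψ, fun v => ?_⟩
    rw [Language.Formula.realize_imp, hφ, hψ]
  | false => exact ⟨⊥, fun v => by simp⟩
  | @all P _ h =>
    obtain ⟨φ, hφ⟩ := h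
    let g : ℕ ⊕ M → (ℕ ⊕ M) ⊕ Unit := Sum.elim
      (fun n => Nat.casesOn n (Sum.inr ()) (fun k => Sum.inl (Sum.inl k)))
      (fun m => Sum.inl (Sum.inr m))
    refine ⟨(Language.Formula.relabel g φ).iAlls Unit, fun v => ?_⟩
    rw [Language.Formula.realize_iAlls]
    have key : ∀ y : A, Language.Formula.Realize (Language.Formula.relabel g φ)
        (fun a => Sum.elim (Sum.elim v (Set.inclusion hMA)) (fun _ : Unit => y) a) ↔
        P (scons y (fun n => v n)) := by
      intro y
      rw [Language.Formula.realize_relabel]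
      let w : ℕ → A := fun n => Nat.casesOn n y v
      have h1 : (fun a => Sum.elim (Sum.elim v (Set.inclusion hMA)) (fun _ : Unit => y) a) ∘ g
          = Sum.elim w (Set.inclusion hMA) := by
        funext a
        rcases a with (_ | n) | m <;> rfl
      have h2 : (fun n => (w n).1) = scons y (fun n => v n) := by
        funext n; cases n <;> rfl
      rw [h1, hφ, h2]
    constructor
    · intro h y hy
      exact (key ⟨y, hy⟩).1 (h fun _ => ⟨y, hy⟩)
    · intro h i
      exact (key (i ())).2 (h _ (i ()).2)
  | congr _ h1 h =>
    obtain ⟨φ, hφ⟩ := h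
    exact ⟨φ, fun v => (hφ v).trans (h1 _ fun n => (v n).2).symm⟩

/-- Every formula, with some variables replaced by terms, gives a definable predicate. -/
theorem DefP.of_boundedFormula {n : ℕ} (φ : setLang.BoundedFormula Empty n) :
    ∀ e : Fin n → (ℕ → ZFSet.{u}) → ZFSet.{u}, (∀ i, IsTerm M (e i)) →
      ∃ P, DefP A M P ∧ ∀ v : ℕ → ZFSet.{u}, (∀ n, v n ∈ A) → ∀ w : Fin n → A,
        (∀ i, (w i : ZFSet.{u}) = e i v) → (P v ↔ φ.Realize default w) := by
  have hterm : ∀ {n : ℕ} (t : setLang.Term (Empty ⊕ Fin n))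
      (e : Fin n → (ℕ → ZFSet.{u}) → ZFSet.{u}), (∀ i, IsTerm M (e i)) →
      ∃ F, IsTerm M F ∧ ∀ v : ℕ → ZFSet.{u}, ∀ w : Fin n → A,
        (∀ i, (w i : ZFSet.{u}) = e i v) →
        ((t.realize (Sum.elim default w) : A) : ZFSet.{u}) = F v := by
    intro n t e he
    match t with
    | .var (Sum.inl i) => exact i.elim
    | .var (Sum.inr i) => exact ⟨e i, he i, fun v w hw => hw i⟩
    | .func f _ => exact f.elim
  induction φ with
  | falsum => exact fun e _ => ⟨_, .false, fun v _ w _ => Iff.rfl⟩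
  | equal s t =>
    intro e he
    obtain ⟨F, hF, hF'⟩ := hterm s e he
    obtain ⟨G, hG, hG'⟩ := hterm t e he
    refine ⟨_, .eq hF hG, fun v _ w hw => ?_⟩
    simp only [Language.BoundedFormula.Realize, ← hF' v w hw, ← hG' v w hw]
    exact Subtype.ext_iff.symm
  | rel R ts =>
    cases R
    intro e he
    obtain ⟨F, hF, hF'⟩ := hterm (ts 0) e he
    obtain ⟨G, hG, hG'⟩ := hterm (ts 1) e he
    refine ⟨_, .mem hF hG, fun v _ w hw => ?_⟩
    rw [← hF' v w hw, ← hG' v w hw]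
    exact Iff.rfl
  | imp _ _ h1 h2 =>
    intro e he
    obtain ⟨P, hP, hP'⟩ := h1 e he
    obtain ⟨Q, hQ, hQ'⟩ := h2 e he
    refine ⟨_, .imp hP hQ, fun v hv w hw => ?_⟩
    rw [hP' v hv w hw, hQ' v hv w hw, Language.BoundedFormula.realize_imp]
  | @all n φ h =>
    intro e he
    obtain ⟨P, hP, hP'⟩ := h
      (Fin.snoc (α := fun _ => (ℕ → ZFSet.{u}) → ZFSet.{u})
        (fun i v => e i (fun n => v (n + 1))) (fun v => v 0)) (by
        intro i
        refine Fin.lastCases ?_ (fun i => ?_) i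
        · rw [Fin.snoc_last]; exact Or.inl ⟨0, rfl⟩
        · rw [Fin.snoc_castSucc]
          rcases he i with ⟨j, hj⟩ | ⟨a, ha, hj⟩
          · exact Or.inl ⟨j + 1, by rw [hj]⟩
          · exact Or.inr ⟨a, ha, by rw [hj]⟩)
    refine ⟨_, .all hP, fun v hv w hw => ?_⟩
    rw [Language.BoundedFormula.realize_all]
    have key : ∀ y : A, P (scons y v) ↔ φ.Realize default (Fin.snoc w y) := by
      intro y
      refine hP' _ (scons_mem y.2 hv) _ fun i => ?_
      refine Fin.lastCases ?_ (fun i => ?_) i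
      · rw [Fin.snoc_last, Fin.snoc_last]; rfl
      · rw [Fin.snoc_castSucc, Fin.snoc_castSucc]; exact hw i
    exact ⟨fun h y => (key y).1 (h y y.2), fun h y hy => (key ⟨y, hy⟩).2 (h ⟨y, hy⟩)⟩

/-- The **Tarski–Vaught test**, in terms of definable predicates. As `Q` is applied to the variable
`0` only, it is a definable property of a single set. -/
theorem isElementarySubmodel_iff : IsElementarySubmodel M A ↔ M ⊆ A ∧
    ∀ Q : ZFSet.{u} → Prop, DefP A M (fun v => Q (v 0)) → (∃ y ∈ A, Q y) → ∃ y ∈ M, Q y := by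
  constructor
  · rintro ⟨e, he⟩
    have hMA : M ⊆ A := fun x hx => by
      have := (e ⟨x, hx⟩).2
      rwa [he] at this
    refine ⟨hMA, ?_⟩
    rintro Q hQ ⟨y, hy, hQy⟩
    obtain ⟨φ, hφ⟩ := hQ.exists_formula hMA
    let g : ℕ ⊕ M → M ⊕ Unit := Sum.elim (fun _ => Sum.inr ()) Sum.inl
    let ψ : setLang.Formula M := (Language.Formula.relabel g φ).iExs Unit
    have heq : (fun m : M => e m) = Set.inclusion hMA := funext fun m => Subtype.ext (he m)
    have h1 : ψ.Realize (Set.inclusion hMA) := by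
      rw [Language.Formula.realize_iExs]
      refine ⟨fun _ => ⟨y, hy⟩, ?_⟩
      rw [Language.Formula.realize_relabel]
      have : (fun a => Sum.elim (Set.inclusion hMA) (fun _ : Unit => (⟨y, hy⟩ : A)) a) ∘ g =
          Sum.elim (fun _ => ⟨y, hy⟩) (Set.inclusion hMA) := by
        funext a; rcases a with n | m <;> rfl
      exact (Iff.of_eq (congrArg φ.Realize this)).2 ((hφ _).2 hQy)
    have h2 : ψ.Realize (id : M → M) := by
      rw [← e.map_formula]
      exact (Iff.of_eq (congrArg ψ.Realize heq)).2 h1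
    rw [Language.Formula.realize_iExs] at h2
    obtain ⟨z, hz⟩ := h2
    rw [Language.Formula.realize_relabel, ← e.map_formula] at hz
    refine ⟨z (), (z ()).2, ?_⟩
    refine (hφ (fun _ => Set.inclusion hMA (z ()))).1 ?_
    refine (Iff.of_eq (congrArg φ.Realize ?_)).1 hz
    funext a
    rcases a with n | m
    · exact congrFun heq _
    · exact congrFun heq _
  · rintro ⟨hMA, h⟩
    let f : M ↪[setLang] A :=
      { toFun := Set.inclusion hMA
        inj' := Set.inclusion_injective hMA
        map_fun' := fun f => f.elim
        map_rel' := fun r x => by cases r; exact Iff.rfl }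
    have hf : ∀ (n : ℕ) (φ : setLang.BoundedFormula Empty (n + 1)) (x : Fin n → M) (a : A),
        φ.Realize default (Fin.snoc (f ∘ x) a : _ → A) →
        ∃ b : M, φ.Realize default (Fin.snoc (f ∘ x) (f b) : _ → A) := by
      intro n φ x a ha
      obtain ⟨P, hP, hP'⟩ := DefP.of_boundedFormula (A := A) (M := M) φ
        (Fin.snoc (α := fun _ => (ℕ → ZFSet.{u}) → ZFSet.{u}) (fun i _ => x i) (fun v => v 0)) (by
          intro i
          refine Fin.lastCases ?_ (fun i => ?_) i
          · rw [Fin.snoc_last]; exact Or.inl ⟨0, rfl⟩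
          · rw [Fin.snoc_castSucc]; exact Or.inr ⟨x i, (x i).2, rfl⟩)
      have key : ∀ v : ℕ → ZFSet.{u}, (hv : ∀ n, v n ∈ A) →
          (P v ↔ φ.Realize default (Fin.snoc (f ∘ x) ⟨v 0, hv 0⟩ : _ → A)) := by
        intro v hv
        refine hP' v hv _ fun i => ?_
        refine Fin.lastCases ?_ (fun i => ?_) i
        · rw [Fin.snoc_last, Fin.snoc_last]
        · rw [Fin.snoc_castSucc, Fin.snoc_castSucc]; rfl
      obtain ⟨b, hb, hb'⟩ := h (fun y => ∃ hy : y ∈ A,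
        φ.Realize default (Fin.snoc (f ∘ x) ⟨y, hy⟩ : _ → A))
        (.congr hP fun v hv => by rw [key v hv]; exact ⟨fun ⟨_, h⟩ => h, fun h => ⟨hv 0, h⟩⟩)
        ⟨a, a.2, a.2, ha⟩
      obtain ⟨_, hb'⟩ := hb'
      exact ⟨⟨b, hb⟩, hb'⟩
    exact ⟨f.toElementaryEmbedding hf, fun x => rfl⟩

/-! ### Calculus of definable predicates and functions -/

/-- `A` is a transitive class closed under subsets, unordered pairs, unions and replacement. -/
class IsClosedClass (A : Set ZFSet.{u}) : Prop where
  empty_mem : ∅ ∈ A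
  mem_of_mem : ∀ {x y : ZFSet.{u}}, x ∈ y → y ∈ A → x ∈ A
  mem_of_subset : ∀ {x y : ZFSet.{u}}, x ⊆ y → y ∈ A → x ∈ A
  upair_mem : ∀ {x y : ZFSet.{u}}, x ∈ A → y ∈ A → ({x, y} : ZFSet.{u}) ∈ A
  sUnion_mem : ∀ {x : ZFSet.{u}}, x ∈ A → ZFSet.sUnion x ∈ A
  range_mem : ∀ {x : ZFSet.{u}} (F : ZFSet.{u} → ZFSet.{u}), x ∈ A → (∀ y ∈ x, F y ∈ A) →
    ZFSet.range (fun y : x => F y) ∈ A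

/-- `F` is a function from assignments to sets which is definable over `A` with parameters in
`M`, and under which the class `A` is closed. -/
structure DefF (A M : Set ZFSet.{u}) (F : (ℕ → ZFSet.{u}) → ZFSet.{u}) : Prop where
  mem : ∀ v, (∀ n, v n ∈ A) → F v ∈ A
  graph : DefP A M (fun v => v 0 = F (fun n => v (n + 1)))

namespace DefP

variable {P Q : (ℕ → ZFSet.{u}) → Prop}

theorem rename (h : DefP A M P) : ∀ σ : ℕ → ℕ, DefP A M (fun v => P (fun n => v (σ n))) := by
  have hterm : ∀ {F : (ℕ → ZFSet.{u}) → ZFSet.{u}}, IsTerm M F → ∀ σ : ℕ → ℕ,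
      IsTerm M (fun v => F (fun n => v (σ n))) := by
    rintro F (⟨i, rfl⟩ | ⟨a, ha, rfl⟩) σ
    · exact Or.inl ⟨σ i, rfl⟩
    · exact Or.inr ⟨a, ha, rfl⟩
  induction h with
  | mem hF hG => exact fun σ => .mem (hterm hF σ) (hterm hG σ)
  | eq hF hG => exact fun σ => .eq (hterm hF σ) (hterm hG σ)
  | imp _ _ h1 h2 => exact fun σ => .imp (h1 σ) (h2 σ)
  | false => exact fun _ => .false
  | @all P _ h =>
    intro σ
    refine .congr (.all (h (fun n => Nat.casesOn n 0 (fun k => σ k + 1)))) fun v hv => ?_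
    refine forall₂_congr fun y _ => iff_of_eq (congrArg P ?_)
    funext n; cases n <;> rfl
  | congr _ h h1 => exact fun σ => .congr (h1 σ) fun v hv => h _ fun n => hv _

theorem mono (hMN : M ⊆ N) (h : DefP A M P) : DefP A N P := by
  have hterm : ∀ {F : (ℕ → ZFSet.{u}) → ZFSet.{u}}, IsTerm M F → IsTerm N F := by
    rintro F (⟨i, rfl⟩ | ⟨a, ha, rfl⟩)
    · exact Or.inl ⟨i, rfl⟩
    · exact Or.inr ⟨a, hMN ha, rfl⟩
  induction h with
  | mem hF hG => exact .mem (hterm hF) (hterm hG)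
  | eq hF hG => exact .eq (hterm hF) (hterm hG)
  | imp _ _ h1 h2 => exact .imp h1 h2
  | false => exact .false
  | all _ h => exact .all h
  | congr _ h h1 => exact .congr h1 h

theorem not (h : DefP A M P) : DefP A M (fun v => ¬ P v) := h.imp .false

theorem and (h : DefP A M P) (h' : DefP A M Q) : DefP A M (fun v => P v ∧ Q v) :=
  (h.imp h'.not).not.congr fun v _ => by tauto

theorem or (h : DefP A M P) (h' : DefP A M Q) : DefP A M (fun v => P v ∨ Q v) :=
  (h.not.imp h').congr fun v _ => by tauto

theorem iff (h : DefP A M P) (h' : DefP A M Q) : DefP A M (fun v => P v ↔ Q v) :=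
  ((h.imp h').and (h'.imp h)).congr fun v _ => by tauto

theorem forall_mem {P : ZFSet.{u} → (ℕ → ZFSet.{u}) → Prop}
    (h : DefP A M (fun v => P (v 0) (fun n => v (n + 1)))) :
    DefP A M (fun v => ∀ y ∈ A, P y v) := h.all

theorem exists_mem {P : ZFSet.{u} → (ℕ → ZFSet.{u}) → Prop}
    (h : DefP A M (fun v => P (v 0) (fun n => v (n + 1)))) :
    DefP A M (fun v => ∃ y ∈ A, P y v) :=
  (forall_mem (P := fun y v => ¬ P y v) h.not).not.congr fun v _ => by push Not; rfl

/-- Substitution of a definable function for a variable. -/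
theorem subst {P : ZFSet.{u} → (ℕ → ZFSet.{u}) → Prop} {F : (ℕ → ZFSet.{u}) → ZFSet.{u}}
    (hF : DefF A M F) (h : DefP A M (fun v => P (v 0) (fun n => v (n + 1)))) :
    DefP A M (fun v => P (F v) v) :=
  (exists_mem (P := fun y v => y = F v ∧ P y v) (hF.graph.and h)).congr fun v hv =>
    ⟨fun h => ⟨F v, hF.mem v hv, rfl, h⟩, fun ⟨_, _, h, h'⟩ => h ▸ h'⟩

end DefP

namespace DefF

variable {F G : (ℕ → ZFSet.{u}) → ZFSet.{u}}

theorem var (i : ℕ) : DefF A M (fun v => v i) :=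
  ⟨fun _ hv => hv i, .eq (.inl ⟨0, rfl⟩) (.inl ⟨i + 1, rfl⟩)⟩

theorem shift (h : DefF A M F) : DefF A M (fun v => F (fun n => v (n + 1))) :=
  ⟨fun _ hv => h.mem _ fun _ => hv _,
    (h.graph.rename (fun n => Nat.casesOn n 0 (fun k => k + 2)))⟩

end DefF

theorem IsElementarySubmodel.subset (hM : IsElementarySubmodel M A) : M ⊆ A :=
  (isElementarySubmodel_iff.1 hM).1

theorem DefF.const (hM : IsElementarySubmodel M A) {a : ZFSet.{u}} (ha : a ∈ M) :
    DefF A M (fun _ => a) :=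
  ⟨fun _ _ => hM.subset ha, .eq (.inl ⟨0, rfl⟩) (.inr ⟨a, ha, rfl⟩)⟩

/-- Elementary submodels contain witnesses of definable existential statements. -/
theorem IsElementarySubmodel.exists_mem (hM : IsElementarySubmodel M A) {Q : ZFSet.{u} → Prop}
    (hQ : DefP A M (fun v => Q (v 0))) (h : ∃ y ∈ A, Q y) : ∃ y ∈ M, Q y :=
  (isElementarySubmodel_iff.1 hM).2 Q hQ h


/-- Elementary submodels are closed under definable functions. -/
theorem IsElementarySubmodel.mem_of_defF [IsClosedClass A] (hM : IsElementarySubmodel M A)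
    {a : ZFSet.{u}} (ha : DefF A M (fun _ => a)) : a ∈ M := by
  obtain ⟨y, hy, rfl⟩ := hM.exists_mem (Q := fun y => y = a) ha.graph
    ⟨a, ha.mem (fun _ => ∅) fun _ => IsClosedClass.empty_mem, rfl⟩
  exact hy

/-- Elements which are uniquely characterized by a definable property. -/
theorem IsElementarySubmodel.mem_of_unique (hM : IsElementarySubmodel M A) {a : ZFSet.{u}}
    (Q : ZFSet.{u} → Prop) (hQ : DefP A M (fun v => Q (v 0))) (ha : a ∈ A) (hQa : Q a)
    (h : ∀ b ∈ A, Q b → b = a) : a ∈ M := by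
  obtain ⟨y, hy, hQy⟩ := hM.exists_mem hQ ⟨a, ha, hQa⟩
  exact h y (hM.subset hy) hQy ▸ hy

section Calculus

variable {F G : (ℕ → ZFSet.{u}) → ZFSet.{u}}

theorem DefP.mem' (hF : DefF A M F) (hG : DefF A M G) : DefP A M (fun v => F v ∈ G v) :=
  .subst (P := fun y v => y ∈ G v) hF <| .subst (P := fun y v => v 0 ∈ y) hG.shift <|
    .mem (.inl ⟨1, rfl⟩) (.inl ⟨0, rfl⟩)

theorem DefP.eq' (hF : DefF A M F) (hG : DefF A M G) : DefP A M (fun v => F v = G v) :=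
  .subst (P := fun y v => y = G v) hF <| .subst (P := fun y v => v 0 = y) hG.shift <|
    .eq (.inl ⟨1, rfl⟩) (.inl ⟨0, rfl⟩)

theorem DefF.congr (hF : DefF A M F) (h : ∀ v, G v = F v) : DefF A M G := by
  obtain rfl : G = F := funext h
  exact hF

variable [IsClosedClass A]

theorem DefP.ball (hF : DefF A M F) {P : ZFSet.{u} → (ℕ → ZFSet.{u}) → Prop}
    (h : DefP A M (fun v => P (v 0) (fun n => v (n + 1)))) :
    DefP A M (fun v => ∀ y ∈ F v, P y v) :=
  (forall_mem (P := fun y v => y ∈ F v → P y v) (.imp (.mem' (.var 0) hF.shift) h)).congr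
    fun v hv => ⟨fun h y _ => h y,
      fun h y hy => h y (IsClosedClass.mem_of_mem hy (hF.mem v hv)) hy⟩

theorem DefP.bex (hF : DefF A M F) {P : ZFSet.{u} → (ℕ → ZFSet.{u}) → Prop}
    (h : DefP A M (fun v => P (v 0) (fun n => v (n + 1)))) :
    DefP A M (fun v => ∃ y ∈ F v, P y v) :=
  (exists_mem (P := fun y v => y ∈ F v ∧ P y v) (.and (.mem' (.var 0) hF.shift) h)).congr
    fun v hv => ⟨fun ⟨y, h, h'⟩ => ⟨y, IsClosedClass.mem_of_mem h (hF.mem v hv), h, h'⟩,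
      fun ⟨y, _, h, h'⟩ => ⟨y, h, h'⟩⟩

/-- A function is definable if the membership relation of its values is. -/
theorem DefF.of_mem (hF : ∀ v, (∀ n, v n ∈ A) → F v ∈ A)
    (h : DefP A M (fun v => v 0 ∈ F (fun n => v (n + 1)))) : DefF A M F := by
  refine ⟨hF, ?_⟩
  refine (DefP.forall_mem (P := fun z v => z ∈ v 0 ↔ z ∈ F (fun n => v (n + 1)))
    (.iff (.mem' (.var 0) (.var 1)) ?_)).congr fun v hv => ⟨fun h z _ => by rw [h], fun h => ?_⟩
  · exact h.rename (fun n => Nat.casesOn n 0 (fun k => k + 2))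
  · ext z
    exact ⟨fun hz => (h z (IsClosedClass.mem_of_mem hz (hv 0))).1 hz, fun hz =>
      (h z (IsClosedClass.mem_of_mem hz (hF _ fun n => hv _))).2 hz⟩

theorem DefF.empty : DefF A M (fun _ => ∅) :=
  .of_mem (fun _ _ => IsClosedClass.empty_mem) (DefP.false.congr fun v _ => by simp)

theorem DefF.upair (hF : DefF A M F) (hG : DefF A M G) :
    DefF A M (fun v => ({F v, G v} : ZFSet.{u})) :=
  .of_mem (fun v hv => IsClosedClass.upair_mem (hF.mem v hv) (hG.mem v hv))
    ((DefP.or (.eq' (.var 0) hF.shift) (.eq' (.var 0) hG.shift)).congr fun v _ => by simp)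

theorem DefF.sUnion (hF : DefF A M F) : DefF A M (fun v => ZFSet.sUnion (F v)) :=
  .of_mem (fun v hv => IsClosedClass.sUnion_mem (hF.mem v hv))
    ((DefP.bex (P := fun y v => v 0 ∈ y) hF.shift (.mem' (.var 1) (.var 0))).congr
      fun v _ => by simp)

theorem DefF.pair (hF : DefF A M F) (hG : DefF A M G) :
    DefF A M (fun v => ZFSet.pair (F v) (G v)) :=
  (DefF.upair (hF.upair hF) (hF.upair hG)).congr fun v => by
    rw [ZFSet.pair_eq_singleton]; rfl

theorem DefF.succ (hF : DefF A M F) : DefF A M (fun v => insert (F v) (F v)) :=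
  (DefF.upair (hF.upair hF) hF).sUnion.congr fun v => by ext; simp

end Calculus

/-! ### Functions as sets -/

/-- The value `f(x)` of a function `f`, and `∅` if `x` is not in its domain; in general, the
union of all `y` with `(x, y) ∈ f`. -/
noncomputable def app (f x : ZFSet.{u}) : ZFSet.{u} :=
  ZFSet.sep (fun z => ∃ y, ZFSet.pair x y ∈ f ∧ z ∈ y)
    (ZFSet.sUnion (ZFSet.sUnion (ZFSet.sUnion f)))

theorem mem_sUnion_sUnion_of_pair_mem {f x y : ZFSet.{u}} (h : ZFSet.pair x y ∈ f) :
    x ∈ ZFSet.sUnion (ZFSet.sUnion f) ∧ y ∈ ZFSet.sUnion (ZFSet.sUnion f) := by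
  have h1 : ({x, y} : ZFSet.{u}) ∈ ZFSet.sUnion f :=
    ZFSet.mem_sUnion.2 ⟨_, h, by simp [ZFSet.pair]⟩
  exact ⟨ZFSet.mem_sUnion.2 ⟨_, h1, by simp⟩, ZFSet.mem_sUnion.2 ⟨_, h1, by simp⟩⟩

theorem mem_app {f x z : ZFSet.{u}} : z ∈ app f x ↔ ∃ y, ZFSet.pair x y ∈ f ∧ z ∈ y := by
  rw [app, ZFSet.mem_sep, and_iff_right_iff_imp]
  rintro ⟨y, hy, hz⟩
  exact ZFSet.mem_sUnion.2 ⟨y, (mem_sUnion_sUnion_of_pair_mem hy).2, hz⟩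

theorem isFunction_iff {f : ZFSet.{u}} : IsFunction f ↔
    (∀ p ∈ f, ∃ a b, p = ZFSet.pair a b) ∧
      ∀ a b c, ZFSet.pair a b ∈ f → ZFSet.pair a c ∈ f → b = c := by
  constructor
  · rintro ⟨d, r, hf, h⟩
    refine ⟨fun p hp => ?_, fun a b c hb hc => ?_⟩
    · obtain ⟨a, -, b, -, h⟩ := ZFSet.mem_prod.1 (hf hp)
      exact ⟨a, b, h⟩
    · exact (h a (ZFSet.pair_mem_prod.1 (hf hb)).1).unique hb hc
  · rintro ⟨h1, h2⟩
    refine ⟨ZFSet.sep (fun a => ∃ b, ZFSet.pair a b ∈ f) (ZFSet.sUnion (ZFSet.sUnion f)),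
      ZFSet.sUnion (ZFSet.sUnion f), fun p hp => ?_, fun a ha => ?_⟩
    · obtain ⟨a, b, rfl⟩ := h1 p hp
      have := mem_sUnion_sUnion_of_pair_mem hp
      exact ZFSet.pair_mem_prod.2 ⟨ZFSet.mem_sep.2 ⟨this.1, b, hp⟩, this.2⟩
    · obtain ⟨b, hb⟩ := (ZFSet.mem_sep.1 ha).2
      exact ⟨b, hb, fun c hc => h2 _ _ _ hc hb⟩

theorem IsFunction.app_eq {f x y : ZFSet.{u}} (hf : IsFunction f) (h : ZFSet.pair x y ∈ f) :
    app f x = y := by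
  ext z
  rw [mem_app]
  exact ⟨fun ⟨y', hy', hz⟩ => (isFunction_iff.1 hf).2 _ _ _ h hy' ▸ hz, fun hz => ⟨y, h, hz⟩⟩

theorem _root_.ZFSet.IsFunc.isFunction {X Y f : ZFSet.{u}} (hf : ZFSet.IsFunc X Y f) :
    IsFunction f := ⟨X, Y, hf⟩

theorem _root_.ZFSet.IsFunc.pair_app_mem {X Y f x : ZFSet.{u}} (hf : ZFSet.IsFunc X Y f)
    (hx : x ∈ X) : ZFSet.pair x (app f x) ∈ f := by
  obtain ⟨y, hy, -⟩ := hf.2 x hx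
  rwa [hf.isFunction.app_eq hy]

theorem _root_.ZFSet.IsFunc.app_mem {X Y f x : ZFSet.{u}} (hf : ZFSet.IsFunc X Y f)
    (hx : x ∈ X) : app f x ∈ Y :=
  (ZFSet.pair_mem_prod.1 (hf.1 (hf.pair_app_mem hx))).2

/-- The function `x ↦ F x` with domain `X`, as a set. -/
noncomputable def graph (X : ZFSet.{u}) (F : ZFSet.{u} → ZFSet.{u}) : ZFSet.{u} :=
  ZFSet.range (fun x : X => ZFSet.pair x (F x))

theorem mem_graph {X p : ZFSet.{u}} {F : ZFSet.{u} → ZFSet.{u}} :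
    p ∈ graph X F ↔ ∃ x ∈ X, p = ZFSet.pair x (F x) := by
  rw [graph, ZFSet.mem_range]
  exact ⟨fun ⟨x, h⟩ => ⟨x, x.2, h.symm⟩, fun ⟨x, hx, h⟩ => ⟨⟨x, hx⟩, h.symm⟩⟩

theorem pair_mem_graph {X x y : ZFSet.{u}} {F : ZFSet.{u} → ZFSet.{u}} :
    ZFSet.pair x y ∈ graph X F ↔ x ∈ X ∧ y = F x := by
  rw [mem_graph]
  constructor
  · rintro ⟨a, ha, h⟩
    obtain ⟨rfl, rfl⟩ := ZFSet.pair_inj.1 h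
    exact ⟨ha, rfl⟩
  · rintro ⟨hx, rfl⟩
    exact ⟨x, hx, rfl⟩

theorem isFunc_graph {X Y : ZFSet.{u}} {F : ZFSet.{u} → ZFSet.{u}} (h : ∀ x ∈ X, F x ∈ Y) :
    ZFSet.IsFunc X Y (graph X F) := by
  refine ⟨fun p hp => ?_, fun x hx => ⟨F x, pair_mem_graph.2 ⟨hx, rfl⟩,
    fun y hy => (pair_mem_graph.1 hy).2⟩⟩
  obtain ⟨x, hx, rfl⟩ := mem_graph.1 hp
  exact ZFSet.pair_mem_prod.2 ⟨hx, h x hx⟩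

theorem isFunction_graph {X : ZFSet.{u}} {F : ZFSet.{u} → ZFSet.{u}} :
    IsFunction (graph X F) :=
  (isFunc_graph (Y := ZFSet.range (fun x : X => F x))
    fun x hx => ZFSet.mem_range.2 ⟨⟨x, hx⟩, rfl⟩).isFunction

theorem app_graph {X x : ZFSet.{u}} {F : ZFSet.{u} → ZFSet.{u}} (hx : x ∈ X) :
    app (graph X F) x = F x :=
  isFunction_graph.app_eq (pair_mem_graph.2 ⟨hx, rfl⟩)

section ClosedClass

variable [IsClosedClass A]

theorem app_mem_of_mem {f : ZFSet.{u}} (hf : f ∈ A) (x : ZFSet.{u}) : app f x ∈ A :=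
  IsClosedClass.mem_of_subset ZFSet.sep_subset (IsClosedClass.sUnion_mem
    (IsClosedClass.sUnion_mem (IsClosedClass.sUnion_mem hf)))

theorem pair_mem_class {x y : ZFSet.{u}} (hx : x ∈ A) (hy : y ∈ A) : ZFSet.pair x y ∈ A := by
  have := IsClosedClass.upair_mem (IsClosedClass.upair_mem hx hx) (IsClosedClass.upair_mem hx hy)
  rwa [ZFSet.pair_eq_singleton] at this

theorem of_pair_mem_class {f x y : ZFSet.{u}} (hf : f ∈ A) (h : ZFSet.pair x y ∈ f) :
    x ∈ A ∧ y ∈ A :=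
  have h' := mem_sUnion_sUnion_of_pair_mem h
  have hA := IsClosedClass.sUnion_mem (IsClosedClass.sUnion_mem hf)
  ⟨IsClosedClass.mem_of_mem h'.1 hA, IsClosedClass.mem_of_mem h'.2 hA⟩

theorem graph_mem_class {X : ZFSet.{u}} {F : ZFSet.{u} → ZFSet.{u}} (hX : X ∈ A)
    (h : ∀ x ∈ X, F x ∈ A) : graph X F ∈ A :=
  IsClosedClass.range_mem (fun x => ZFSet.pair x (F x)) hX fun x hx =>
    pair_mem_class (IsClosedClass.mem_of_mem hx hX) (h x hx)

theorem prod_mem_class {X Y : ZFSet.{u}} (hX : X ∈ A) (hY : Y ∈ A) : ZFSet.prod X Y ∈ A := by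
  have h : ∀ x ∈ X, graph Y (fun _ => x) ∈ A := fun x hx =>
    graph_mem_class hY fun _ _ => IsClosedClass.mem_of_mem hx hX
  refine IsClosedClass.mem_of_subset (fun p hp => ?_)
    (IsClosedClass.sUnion_mem (IsClosedClass.range_mem
      (fun x => ZFSet.range (fun y : Y => ZFSet.pair x y)) hX fun x hx =>
        IsClosedClass.range_mem (fun y => ZFSet.pair x y) hY fun y hy =>
          pair_mem_class (IsClosedClass.mem_of_mem hx hX) (IsClosedClass.mem_of_mem hy hY)))
  obtain ⟨x, hx, y, hy, rfl⟩ := ZFSet.mem_prod.1 hp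
  exact ZFSet.mem_sUnion.2 ⟨_, ZFSet.mem_range.2 ⟨⟨x, hx⟩, rfl⟩, ZFSet.mem_range.2 ⟨⟨y, hy⟩, rfl⟩⟩

variable {F G : (ℕ → ZFSet.{u}) → ZFSet.{u}}

theorem DefF.app (hF : DefF A M F) (hG : DefF A M G) : DefF A M (fun v => app (F v) (G v)) :=
  .of_mem (fun v hv => app_mem_of_mem (hF.mem v hv) _)
    ((DefP.exists_mem (P := fun y v => ZFSet.pair (G (fun n => v (n + 1))) y ∈
        F (fun n => v (n + 1)) ∧ v 0 ∈ y)
      (.and (.mem' (.pair hG.shift.shift (.var 0)) hF.shift.shift)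
        (.mem' (.var 1) (.var 0)))).congr fun v hv => by
      rw [mem_app]
      exact ⟨fun ⟨y, h⟩ => ⟨y, (of_pair_mem_class (hF.mem _ fun n => hv _) h.1).2, h⟩,
        fun ⟨y, _, h⟩ => ⟨y, h⟩⟩)

theorem DefP.isFunction (hF : DefF A M F) : DefP A M (fun v => IsFunction (F v)) := by
  refine .subst (P := fun f _ => IsFunction f) hF ?_
  refine (DefP.and
    (.ball (P := fun p _ => ∃ a ∈ A, ∃ b ∈ A, p = ZFSet.pair a b) (.var 0)
      (.exists_mem (.exists_mem (.eq' (.var 2) (.pair (.var 1) (.var 0))))))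
    (.forall_mem (P := fun a v => ∀ b ∈ A, ∀ c ∈ A, ZFSet.pair a b ∈ v 0 →
        ZFSet.pair a c ∈ v 0 → b = c)
      (.forall_mem (.forall_mem (.imp (.mem' (.pair (.var 2) (.var 1)) (.var 3))
        (.imp (.mem' (.pair (.var 2) (.var 0)) (.var 3)) (.eq' (.var 1) (.var 0)))))))).congr
    fun v hv => ?_
  rw [isFunction_iff]
  refine and_congr ⟨fun h p hp => ?_, fun h p hp => ?_⟩ ⟨fun h a _ b _ c _ => h a b c,
    fun h a b c hb hc => ?_⟩
  · obtain ⟨a, b, rfl⟩ := h p hp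
    have := of_pair_mem_class (hv 0) hp
    exact ⟨a, this.1, b, this.2, rfl⟩
  · obtain ⟨a, -, b, -, h⟩ := h p hp
    exact ⟨a, b, h⟩
  · have h1 := of_pair_mem_class (hv 0) hb
    exact h a h1.1 b h1.2 c (of_pair_mem_class (hv 0) hc).2 hb hc

theorem DefP.isOrdinal (hF : DefF A M F) : DefP A M (fun v => (F v).IsOrdinal) := by
  refine .subst (P := fun x _ => x.IsOrdinal) hF ?_
  refine (DefP.and
    (.ball (P := fun y v => ∀ z ∈ y, z ∈ v 0) (.var 0)
      (.ball (.var 0) (.mem' (.var 0) (.var 2))))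
    (.ball (P := fun y v => ∀ z ∈ y, ∀ w ∈ z, w ∈ y) (.var 0)
      (.ball (.var 0) (.ball (.var 0) (.mem' (.var 0) (.var 2)))))).congr fun v _ => ?_
  rw [ZFSet.isOrdinal_iff_forall_mem_isTransitive]
  exact Iff.rfl

end ClosedClass

theorem IsElementarySubmodel.app_mem [IsClosedClass A] (hM : IsElementarySubmodel M A)
    {f x : ZFSet.{u}} (hf : f ∈ M) (hx : x ∈ M) : app f x ∈ M :=
  hM.mem_of_defF (.app (.const hM hf) (.const hM hx))

/-! ### Hulls and unions of chains -/

section Hull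

variable [IsClosedClass A] {X x : ZFSet.{u}}

theorem hull_countable (hM : M.Countable) (x : ZFSet.{u}) : (Hull M x).Countable :=
  (hM.image fun f => app f x).mono fun y hy => by
    obtain ⟨f, hf, hf', h⟩ := hy
    exact ⟨f, hf, hf'.app_eq h⟩

theorem hull_subset_class (hM : IsElementarySubmodel M A) : Hull M x ⊆ A :=
  fun _ ⟨_, hf, _, h⟩ => (of_pair_mem_class (hM.subset hf) h).2

theorem subset_hull (hM : IsElementarySubmodel M A) (hX : X ∈ M) (hx : x ∈ X) :
    M ⊆ Hull M x := by
  intro a ha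
  obtain ⟨f, hf, hf', h⟩ := hM.exists_mem
    (Q := fun f => IsFunction f ∧ ∀ x ∈ X, ZFSet.pair x a ∈ f)
    (.and (.isFunction (.var 0)) (.ball (P := fun x v => ZFSet.pair x a ∈ v 0) (.const hM hX)
      (.mem' (.pair (.var 0) (.const hM ha)) (.var 1))))
    ⟨graph X (fun _ => a), graph_mem_class (hM.subset hX) fun _ _ => hM.subset ha,
      isFunction_graph, fun x hx => pair_mem_graph.2 ⟨hx, rfl⟩⟩
  exact ⟨f, hf, hf', h x hx⟩

theorem mem_hull_self (hM : IsElementarySubmodel M A) (hX : X ∈ M) (hx : x ∈ X) :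
    x ∈ Hull M x := by
  obtain ⟨f, hf, hf', h⟩ := hM.exists_mem
    (Q := fun f => IsFunction f ∧ ∀ x ∈ X, ZFSet.pair x x ∈ f)
    (.and (.isFunction (.var 0)) (.ball (P := fun x v => ZFSet.pair x x ∈ v 0) (.const hM hX)
      (.mem' (.pair (.var 0) (.var 0)) (.var 1))))
    ⟨graph X id, graph_mem_class (hM.subset hX) fun _ hx =>
      IsClosedClass.mem_of_mem hx (hM.subset hX),
      isFunction_graph, fun x hx => pair_mem_graph.2 ⟨hx, rfl⟩⟩
  exact ⟨f, hf, hf', h x hx⟩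

theorem hull_subset (hN : IsElementarySubmodel N A) (hMN : M ⊆ N) (hx : x ∈ N) :
    Hull M x ⊆ N := by
  rintro y ⟨f, hf, hf', h⟩
  rw [← hf'.app_eq h]
  exact hN.app_mem (hMN hf) hx

/-- A predicate with parameters `f_a(x)` in `Hull(M, x)` is definable with the parameters `f_a` in
`M` and the additional variable `x`. -/
theorem DefP.of_hull (hM : IsElementarySubmodel M A) {P : (ℕ → ZFSet.{u}) → Prop}
    (h : DefP A (Hull M x) P) :
    ∃ R, DefP A M R ∧ ∀ v, (∀ n, v n ∈ A) → (R (scons x v) ↔ P v) := by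
  have hterm : ∀ {F : (ℕ → ZFSet.{u}) → ZFSet.{u}}, IsTerm (Hull M x) F →
      ∃ G, DefF A M G ∧ ∀ v, G (scons x v) = F v := by
    rintro F (⟨i, rfl⟩ | ⟨a, ⟨f, hf, hf', h⟩, rfl⟩)
    · exact ⟨_, .var (i + 1), fun v => rfl⟩
    · exact ⟨_, .app (.const hM hf) (.var 0), fun v => hf'.app_eq h⟩
  induction h with
  | mem hF hG =>
    obtain ⟨F, hF, hF'⟩ := hterm hF
    obtain ⟨G, hG, hG'⟩ := hterm hG
    exact ⟨_, .mem' hF hG, fun v _ => by rw [hF', hG']⟩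
  | eq hF hG =>
    obtain ⟨F, hF, hF'⟩ := hterm hF
    obtain ⟨G, hG, hG'⟩ := hterm hG
    exact ⟨_, .eq' hF hG, fun v _ => by rw [hF', hG']⟩
  | imp _ _ h1 h2 =>
    obtain ⟨R, hR, hR'⟩ := h1
    obtain ⟨S, hS, hS'⟩ := h2
    exact ⟨_, .imp hR hS, fun v hv => by rw [hR' v hv, hS' v hv]⟩
  | false => exact ⟨_, .false, fun _ _ => Iff.rfl⟩
  | all _ h =>
    obtain ⟨R, hR, hR'⟩ := h
    refine ⟨_, .forall_mem (P := fun y v => R (scons (v 0) (scons y (fun n => v (n + 1)))))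
      ((hR.rename (fun | 0 => 1 | 1 => 0 | n + 2 => n + 2)).congr fun v _ =>
        iff_of_eq (congrArg R ?_)), fun v hv => ?_⟩
    · funext n
      rcases n with _ | _ | n <;> rfl
    · exact forall₂_congr fun y hy => hR' (scons y v) (scons_mem hy hv)
  | congr _ h1 h =>
    obtain ⟨R, hR, hR'⟩ := h
    exact ⟨R, hR, fun v hv => (hR' v hv).trans (h1 v hv).symm⟩

/-- Hulls of elementary submodels are elementary submodels: Skolem functions `X → A` for a
formula are elements of `A` by replacement, hence there is one in `M`. -/
theorem hull_isElementarySubmodel (hM : IsElementarySubmodel M A) (hX : X ∈ M) (hx : x ∈ X) :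
    IsElementarySubmodel (Hull M x) A := by
  classical
  have hXA := hM.subset hX
  refine isElementarySubmodel_iff.2 ⟨hull_subset_class hM, ?_⟩
  rintro Q hQ ⟨y, hy, hQy⟩
  have hxA : x ∈ A := IsClosedClass.mem_of_mem hx hXA
  obtain ⟨R, hR, hR'⟩ := hQ.of_hull hM
  replace hR' : ∀ y ∈ A, R (scons x (fun _ => y)) ↔ Q y := fun y hy => hR' _ fun _ => hy
  have hR1 : DefP A M (fun v => R (scons (v 1) (fun _ => v 0))) :=
    (hR.rename (fun n => Nat.casesOn n 1 fun _ => 0)).congr fun v _ =>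
      iff_of_eq (congrArg R (by funext n; cases n <;> rfl))
  obtain ⟨g, hg, hg', hdom, hgR⟩ := hM.exists_mem
    (Q := fun g => IsFunction g ∧ (∀ z ∈ X, ∃ y ∈ A, ZFSet.pair z y ∈ g) ∧
      ∀ z ∈ X, (∃ y ∈ A, R (scons z (fun _ => y))) → R (scons z (fun _ => app g z)))
    (.and (.isFunction (.var 0)) (.and
      (.ball (P := fun z v => ∃ y ∈ A, ZFSet.pair z y ∈ v 0) (.const hM hX)
        (.exists_mem (.mem' (.pair (.var 1) (.var 0)) (.var 2))))
      (.ball (P := fun z v => (∃ y ∈ A, R (scons z (fun _ => y))) →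
          R (scons z (fun _ => app (v 0) z))) (.const hM hX)
        (.imp (.exists_mem hR1) (.subst (P := fun y v => R (scons (v 0) (fun _ => y)))
          (.app (.var 1) (.var 0)) hR1)))))
    (by
      let F : ZFSet.{u} → ZFSet.{u} := fun z =>
        if h : ∃ y ∈ A, R (scons z (fun _ => y)) then h.choose else ∅
      have hF : ∀ z ∈ X, F z ∈ A := fun z _ => by
        by_cases h : ∃ y ∈ A, R (scons z (fun _ => y))
        · simp only [F, dif_pos h]; exact h.choose_spec.1
        · simp only [F, dif_neg h]; exact IsClosedClass.empty_mem
      refine ⟨graph X F, graph_mem_class hXA hF, isFunction_graph,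
        fun z hz => ⟨F z, hF z hz, pair_mem_graph.2 ⟨hz, rfl⟩⟩, fun z hz h => ?_⟩
      rw [app_graph hz]
      simp only [F, dif_pos h]
      exact h.choose_spec.2)
  obtain ⟨w, hw, hxw⟩ := hdom x hx
  refine ⟨w, ⟨g, hg, hg', hxw⟩, ?_⟩
  rw [← hg'.app_eq hxw, ← hR' _ (app_mem_of_mem (hM.subset hg) x)]
  exact hgR x hx ⟨y, hy, (hR' y hy).2 hQy⟩

/-- If `M` has an elementary extension `N ≺ A` with the same countable ordinals, then `x ∥ M` for every
`x ∈ N` which belongs to some element of `M`. -/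
theorem parallel_of_mem (hM : IsElementarySubmodel M A) (hN : IsElementarySubmodel N A)
    (hMN : M ⊆ N) (hδ : delta N = delta M) (hX : X ∈ M) (hx : x ∈ X) (hxN : x ∈ N) :
    Parallel x M := by
  have hmono : ∀ {M N : Set ZFSet.{u}}, M ⊆ N → delta M ⊆ delta N := fun h a ha =>
    ZFSet.mem_sep.2 ⟨(ZFSet.mem_sep.1 ha).1, h (ZFSet.mem_sep.1 ha).2⟩
  refine le_antisymm ?_ (hmono (subset_hull hM hX hx))
  rw [← hδ]
  exact hmono (hull_subset hN hMN hxN)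

end Hull

/-- Unions of `ω`-chains of elementary submodels are elementary submodels. -/
theorem iUnion_isElementarySubmodel {N : ℕ → Set ZFSet.{u}} (hN : Monotone N)
    (h : ∀ k, IsElementarySubmodel (N k) A) : IsElementarySubmodel (⋃ k, N k) A := by
  have key : ∀ {P : (ℕ → ZFSet.{u}) → Prop}, DefP A (⋃ k, N k) P → ∃ k, DefP A (N k) P := by
    intro P hP
    have hterm : ∀ {F : (ℕ → ZFSet.{u}) → ZFSet.{u}}, IsTerm (⋃ k, N k) F →
        ∃ k, ∀ l ≥ k, IsTerm (N l) F := by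
      rintro F (⟨i, rfl⟩ | ⟨a, ha, rfl⟩)
      · exact ⟨0, fun l _ => .inl ⟨i, rfl⟩⟩
      · obtain ⟨k, hk⟩ := Set.mem_iUnion.1 ha
        exact ⟨k, fun l hl => .inr ⟨a, hN hl hk, rfl⟩⟩
    induction hP with
    | mem hF hG =>
      obtain ⟨k, hk⟩ := hterm hF
      obtain ⟨l, hl⟩ := hterm hG
      exact ⟨max k l, .mem (hk _ (le_max_left _ _)) (hl _ (le_max_right _ _))⟩
    | eq hF hG =>
      obtain ⟨k, hk⟩ := hterm hF
      obtain ⟨l, hl⟩ := hterm hG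
      exact ⟨max k l, .eq (hk _ (le_max_left _ _)) (hl _ (le_max_right _ _))⟩
    | imp _ _ h1 h2 =>
      obtain ⟨k, hk⟩ := h1
      obtain ⟨l, hl⟩ := h2
      exact ⟨max k l, .imp (hk.mono (hN (le_max_left _ _))) (hl.mono (hN (le_max_right _ _)))⟩
    | false => exact ⟨0, .false⟩
    | all _ h =>
      obtain ⟨k, hk⟩ := h
      exact ⟨k, .all hk⟩
    | congr _ h1 h =>
      obtain ⟨k, hk⟩ := h
      exact ⟨k, .congr hk h1⟩
  refine isElementarySubmodel_iff.2 ⟨Set.iUnion_subset fun k => (h k).subset, fun Q hQ hy => ?_⟩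
  obtain ⟨k, hk⟩ := key hQ
  obtain ⟨y, hy, hQy⟩ := (h k).exists_mem hk hy
  exact ⟨y, Set.mem_iUnion.2 ⟨k, hy⟩, hQy⟩

open Cardinal

/-! ### Cardinalities and the ordinals `ω`, `ω₁`, `ω₂` -/

theorem card_le_iff_exists_surjection {x y : ZFSet.{u}} : x.card ≤ y.card ↔
    ∃ F : ZFSet.{u} → ZFSet.{u}, (∀ a ∈ y, F a ∈ insert ∅ x) ∧ ∀ b ∈ x, ∃ a ∈ y, F a = b := by
  classical
  constructor
  · intro h
    rw [← lift_le.{u + 1}, ← ZFSet.cardinalMk_coe_sort, ← ZFSet.cardinalMk_coe_sort] at h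
    obtain ⟨i⟩ := h
    refine ⟨fun a => if h : ∃ b : x, (i b : ZFSet.{u}) = a then h.choose else ∅,
      fun a _ => ?_, fun b hb => ⟨i ⟨b, hb⟩, (i ⟨b, hb⟩).2, ?_⟩⟩
    · beta_reduce
      split_ifs with h
      · exact ZFSet.mem_insert_of_mem _ h.choose.2
      · exact ZFSet.mem_insert _ _
    · have h : ∃ b' : x, (i b' : ZFSet.{u}) = i ⟨b, hb⟩ := ⟨_, rfl⟩
      simp only [dif_pos h]
      exact congrArg Subtype.val (i.injective (Subtype.ext h.choose_spec))
  · rintro ⟨F, -, hF⟩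
    rw [← lift_le.{u + 1}, ← ZFSet.cardinalMk_coe_sort, ← ZFSet.cardinalMk_coe_sort]
    exact (mk_le_mk_of_subset (s := {b | b ∈ x}) (t := F '' {a | a ∈ y})
      fun b hb => hF b hb).trans mk_image_le

theorem countable_iff_card_le {x : ZFSet.{u}} :
    {y | y ∈ x}.Countable ↔ x.card ≤ ℵ₀ := by
  rw [← le_aleph0_iff_set_countable, ← lift_le.{u + 1} (a := x.card),
    ← ZFSet.cardinalMk_coe_sort, lift_aleph0]
  exact Iff.rfl

/-- The ordinal `ω`, as a set. -/
noncomputable def omegaSet : ZFSet.{u} := Ordinal.omega0.{u}.toZFSet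

theorem mem_ord_succ_iff {c : Cardinal.{u}} {x : ZFSet.{u}} :
    x ∈ (Order.succ c).ord.toZFSet ↔ x.IsOrdinal ∧ x.card ≤ c := by
  rw [Ordinal.mem_toZFSet_iff]
  constructor
  · rintro ⟨a, ha, rfl⟩
    exact ⟨ZFSet.isOrdinal_toZFSet a, by rwa [Ordinal.card_toZFSet, card_le_iff]⟩
  · rintro ⟨h, hc⟩
    refine ⟨x.rank, ?_, h.toZFSet_rank_eq⟩
    rwa [← card_le_iff, ← Ordinal.card_toZFSet, h.toZFSet_rank_eq]

theorem mem_omega1_iff {x : ZFSet.{u}} : x ∈ omega1.{u} ↔ x.IsOrdinal ∧ x.card ≤ ℵ₀ := by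
  rw [← mem_ord_succ_iff, succ_aleph0, ord_aleph]; rfl

theorem mem_omega2_iff {x : ZFSet.{u}} : x ∈ omega2.{u} ↔ x.IsOrdinal ∧ x.card ≤ ℵ_ 1 := by
  rw [← mem_ord_succ_iff, succ_aleph, ord_aleph, one_add_one_eq_two]; rfl

theorem card_omegaSet : omegaSet.{u}.card = ℵ₀ := by
  rw [omegaSet, Ordinal.card_toZFSet, Ordinal.card_omega0]

theorem card_omega1 : omega1.{u}.card = ℵ_ 1 := by
  rw [omega1, Ordinal.card_toZFSet, Ordinal.card_omega]

theorem isOrdinal_omega1 : omega1.{u}.IsOrdinal := ZFSet.isOrdinal_toZFSet _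

theorem isOrdinal_omega2 : omega2.{u}.IsOrdinal := ZFSet.isOrdinal_toZFSet _

theorem omega1_subset_omega2 : omega1.{u} ⊆ omega2 :=
  Ordinal.toZFSet_monotone (Ordinal.omega_le_omega.2 (by norm_num))

theorem omegaSet_subset_omega1 : omegaSet.{u} ⊆ omega1 :=
  Ordinal.toZFSet_monotone (Ordinal.omega0_le_omega 1)

theorem mem_omegaSet_iff {x : ZFSet.{u}} : x ∈ omegaSet.{u} ↔
    x.IsOrdinal ∧ ∀ y ∈ insert x x, y = ∅ ∨ ∃ z ∈ y, y = insert z z := by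
  rw [omegaSet, Ordinal.mem_toZFSet_iff]
  constructor
  · rintro ⟨a, ha, rfl⟩
    refine ⟨ZFSet.isOrdinal_toZFSet a, fun y hy => ?_⟩
    rw [← Ordinal.toZFSet_add_one, Ordinal.mem_toZFSet_iff] at hy
    obtain ⟨b, hb, rfl⟩ := hy
    obtain ⟨n, rfl⟩ := Ordinal.lt_omega0.1 ((Order.lt_add_one_iff.1 hb).trans_lt ha)
    cases n with
    | zero => exact Or.inl (by simp)
    | succ n => exact Or.inr ⟨(n : Ordinal.{u}).toZFSet, by simp, by simp⟩
  · rintro ⟨hx, h⟩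
    refine ⟨x.rank, ?_, hx.toZFSet_rank_eq⟩
    by_contra hlt
    have hmem : omegaSet.{u} ∈ insert x x := by
      rw [← hx.toZFSet_rank_eq, ← Ordinal.toZFSet_add_one, omegaSet,
        Ordinal.toZFSet_mem_toZFSet_iff, Order.lt_add_one_iff]
      exact not_lt.1 hlt
    have hω : omegaSet.{u}.IsOrdinal := ZFSet.isOrdinal_toZFSet _
    rcases h _ hmem with h | ⟨z, hz, h⟩
    · rw [omegaSet, ← Ordinal.toZFSet_zero] at h
      exact Ordinal.omega0_ne_zero (Ordinal.toZFSet_injective h)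
    · rw [← (hω.mem hz).toZFSet_rank_eq, ← Ordinal.toZFSet_add_one, omegaSet] at h
      have hlim := Ordinal.isSuccLimit_omega0.{u}
      have h' := Ordinal.toZFSet_injective h
      have : z.rank < Ordinal.omega0 := h' ▸ lt_add_one z.rank
      exact absurd (hlim.add_one_lt this) (h' ▸ lt_irrefl _)

theorem succ_mem_omega1 {x : ZFSet.{u}} (hx : x ∈ omega1.{u}) : insert x x ∈ omega1.{u} := by
  obtain ⟨h1, h2⟩ := mem_omega1_iff.1 hx
  exact mem_omega1_iff.2 ⟨ZFSet.isOrdinal_succ h1, ZFSet.card_insert_le.trans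
    (add_le_of_le le_rfl h2 one_le_aleph0)⟩

/-- Subsets of `ω₂` of size at most `ℵ₁` are bounded, as the union of the successors of their elements
is an ordinal of size at most `ℵ₁`. -/
theorem exists_bound_of_card_le {S : Set ZFSet.{u}} (hS : ∀ x ∈ S, x ∈ omega2.{u})
    (hc : #S ≤ ℵ_ 1) : ∃ η ∈ omega2.{u}, ∀ x ∈ S, x ∈ η := by
  have hsucc : ∀ x ∈ S, (insert x x : ZFSet.{u}).IsOrdinal ∧ (insert x x).card ≤ ℵ_ 1 := by
    intro x hx
    obtain ⟨h1, h2⟩ := mem_omega2_iff.1 (hS x hx)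
    exact ⟨ZFSet.isOrdinal_succ h1, ZFSet.card_insert_le.trans (add_le_of_le (aleph0_le_aleph 1) h2
      (one_le_aleph0.trans (aleph0_le_aleph 1)))⟩
  have hsub : ∀ x ∈ S, (insert x x : ZFSet.{u}) ⊆ omega2 := fun x hx =>
    isOrdinal_omega2.subset_of_mem (mem_omega2_iff.2 (hsucc x hx))
  refine ⟨ZFSet.sep (fun y => ∃ x ∈ S, y ∈ insert x x) omega2, mem_omega2_iff.2 ⟨?_, ?_⟩,
    fun x hx => ZFSet.mem_sep.2 ⟨hS x hx, x, hx, ZFSet.mem_insert _ _⟩⟩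
  · refine ZFSet.isOrdinal_iff_forall_mem_isTransitive.2 ⟨fun y hy z hz => ?_, fun y hy =>
      (isOrdinal_omega2.mem (ZFSet.mem_sep.1 hy).1).isTransitive⟩
    obtain ⟨hy, x, hx, hyx⟩ := ZFSet.mem_sep.1 hy
    exact ZFSet.mem_sep.2 ⟨isOrdinal_omega2.mem_trans hz hy, x, hx, (hsucc x hx).1.mem_trans hz hyx⟩
  · rw [← lift_le.{u + 1}, ← ZFSet.cardinalMk_coe_sort]
    refine (mk_le_mk_of_subset (t := ⋃ x ∈ S, {y | y ∈ (insert x x : ZFSet.{u})})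
      fun y hy => ?_).trans ((mk_biUnion_le _ _).trans ?_)
    · obtain ⟨-, x, hx, hyx⟩ := ZFSet.mem_sep.1 hy
      exact Set.mem_iUnion₂.2 ⟨x, hx, hyx⟩
    · rw [lift_aleph, Ordinal.lift_one]
      refine mul_le_of_le (aleph0_le_aleph 1) hc (ciSup_le' fun x => ?_)
      have := lift_le.{u + 1}.2 (hsucc x x.2).2
      rwa [← ZFSet.cardinalMk_coe_sort, lift_aleph, Ordinal.lift_one] at this

/-! ### The class `H_θ` -/

/-- A set of fewer than `θ` elements of `H_θ` is in `H_θ`, by regularity of `θ`. -/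
theorem mem_H_of_forall_mem {θ : Cardinal.{u}} (hθ : θ.IsRegular) {z : ZFSet.{u}}
    (hz : z.card < θ) (h : ∀ y ∈ z, y ∈ H θ) : z ∈ H θ := by
  choose! t ht hsub hcard using h
  have hcov : ZFSet.card (ZFSet.iUnion (fun y : Shrink.{u} z => t ((equivShrink z).symm y))) < θ := by
    refine (lift_lt.{u, u}.1 (ZFSet.lift_card_iUnion_le_sum_card.trans_lt ?_))
    rw [lift_id]
    exact sum_lt_of_isRegular hθ hz fun y => hcard _ ((equivShrink z).symm y).2
  have hmem : ∀ y ∈ z, t y ⊆ ZFSet.iUnion (fun y : Shrink.{u} z => t ((equivShrink z).symm y)) :=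
    fun y hy x hx => ZFSet.mem_iUnion.2 ⟨equivShrink z ⟨y, hy⟩, by simpa using hx⟩
  refine ⟨z ∪ ZFSet.iUnion (fun y : Shrink.{u} z => t ((equivShrink z).symm y)), fun y hy => ?_,
    fun y hy => ZFSet.mem_union.2 (.inl hy),
    ZFSet.card_union_le.trans_lt (add_lt_of_lt hθ.aleph0_le hz hcov)⟩
  intro x hx
  refine ZFSet.mem_union.2 (.inr ?_)
  rcases ZFSet.mem_union.1 hy with hy | hy
  · exact hmem y hy (hsub y hy hx)
  · obtain ⟨w, hw⟩ := ZFSet.mem_iUnion.1 hy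
    exact ZFSet.mem_iUnion.2 ⟨w, (ht _ ((equivShrink z).symm w).2).mem_trans hx hw⟩

theorem card_lt_of_mem_H {θ : Cardinal.{u}} {x : ZFSet.{u}} (hx : x ∈ H θ) : x.card < θ := by
  obtain ⟨t, -, h, ht⟩ := hx
  exact (ZFSet.card_mono h).trans_lt ht

theorem isClosedClass_H {θ : Cardinal.{u}} (hθ : θ.IsRegular) : IsClosedClass (H θ) where
  empty_mem := mem_H_of_forall_mem hθ (by simpa using hθ.pos) fun y hy =>
    (ZFSet.notMem_empty y hy).elim
  mem_of_mem := fun hxy ⟨t, ht, h, hc⟩ => ⟨t, ht, ht _ (h hxy), hc⟩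
  mem_of_subset := fun hxy ⟨t, ht, h, hc⟩ => ⟨t, ht, fun _ hz => h (hxy hz), hc⟩
  upair_mem := fun {x y} hx hy => by
    refine mem_H_of_forall_mem hθ ?_ fun z hz => ?_
    · refine ZFSet.card_insert_le.trans_lt ?_
      rw [ZFSet.card_singleton]
      exact add_lt_of_lt hθ.aleph0_le (one_lt_aleph0.trans_le hθ.aleph0_le)
        (one_lt_aleph0.trans_le hθ.aleph0_le)
    · rcases ZFSet.mem_pair.1 hz with rfl | rfl
      exacts [hx, hy]
  sUnion_mem := fun {x} ⟨t, ht, h, hc⟩ => by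
    refine ⟨t, ht, fun y hy => ?_, hc⟩
    obtain ⟨z, hz, hy⟩ := ZFSet.mem_sUnion.1 hy
    exact ht.mem_trans hy (h hz)
  range_mem := fun {x} F hx hF => by
    refine mem_H_of_forall_mem hθ ?_ fun y hy => ?_
    · refine lt_of_le_of_lt ?_ (card_lt_of_mem_H hx)
      have := ZFSet.lift_card_range_le (f := fun y : x => F y)
      rw [ZFSet.cardinalMk_coe_sort, lift_lift, lift_umax.{u, u + 1}] at this
      exact lift_le.1 this
    · obtain ⟨y, rfl⟩ := ZFSet.mem_range.1 hy
      exact hF y y.2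

theorem omega2_mem_H {θ : Cardinal.{u}} (hθ : θ.IsRegular) (h : MuchLess omega2.{u} θ) :
    omega2.{u} ∈ H θ := by
  have := isClosedClass_H hθ
  exact IsClosedClass.mem_of_mem (ZFSet.mem_powerset.2 subset_rfl)
    (IsClosedClass.mem_of_mem (ZFSet.mem_powerset.2 subset_rfl) h)

/-- The set of functions from `ω₁` to `ω₂` has at most `2 ^ ℵ₂` elements, and hence belongs to
`H_θ`. -/
theorem funs_mem_H {θ : Cardinal.{u}} (hθ : θ.IsRegular) (h : MuchLess omega2.{u} θ) :
    ZFSet.funs omega1.{u} omega2 ∈ H θ := by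
  have := isClosedClass_H hθ
  have h2 := omega2_mem_H hθ h
  have hp : ZFSet.prod omega1.{u} omega2 ∈ H θ :=
    prod_mem_class (IsClosedClass.mem_of_subset omega1_subset_omega2 h2) h2
  refine mem_H_of_forall_mem hθ ?_ fun f hf =>
    IsClosedClass.mem_of_subset (ZFSet.mem_funs.1 hf).1 hp
  have hc : (ZFSet.prod omega1.{u} omega2).card ≤ omega2.{u}.card := by
    have hinf : ℵ₀ ≤ omega2.{u}.card := by
      rw [omega2, Ordinal.card_toZFSet, Ordinal.card_omega]; exact aleph0_le_aleph _
    rw [← lift_le.{u + 1}, ← ZFSet.cardinalMk_coe_sort]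
    refine (mk_le_of_injective (β := omega1.{u} × omega2.{u}) (f := fun p =>
      (⟨(ZFSet.mem_prod.1 p.2).choose, (ZFSet.mem_prod.1 p.2).choose_spec.1⟩,
        ⟨(ZFSet.mem_prod.1 p.2).choose_spec.2.choose,
          (ZFSet.mem_prod.1 p.2).choose_spec.2.choose_spec.1⟩)) fun p q hpq => ?_).trans ?_
    · have h1 := (ZFSet.mem_prod.1 p.2).choose_spec.2.choose_spec.2
      have h2 := (ZFSet.mem_prod.1 q.2).choose_spec.2.choose_spec.2
      simp only [Prod.mk.injEq, Subtype.mk.injEq] at hpq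
      exact Subtype.ext (h1.trans ((congrArg₂ ZFSet.pair hpq.1 hpq.2).trans h2.symm))
    · rw [mk_prod, lift_id, lift_id, ZFSet.cardinalMk_coe_sort, ZFSet.cardinalMk_coe_sort,
        ← lift_mul, lift_le]
      exact mul_le_of_le hinf (ZFSet.card_mono omega1_subset_omega2) le_rfl
  calc (ZFSet.funs omega1.{u} omega2).card
      ≤ (ZFSet.prod omega1.{u} omega2).powerset.card := ZFSet.card_mono fun f hf =>
        ZFSet.mem_powerset.2 (ZFSet.mem_funs.1 hf).1
    _ ≤ omega2.{u}.powerset.card := by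
        rw [ZFSet.card_powerset, ZFSet.card_powerset]
        exact power_le_power_left two_ne_zero hc
    _ < θ := card_lt_of_mem_H (IsClosedClass.mem_of_mem (ZFSet.mem_powerset.2 subset_rfl) h)

/-! ### Elements of elementary submodels -/

section Submodel

variable [IsClosedClass A]

/-- The ordinal `ω` is definable in `A`: its elements are the ordinals `x` such that all `y ≤ x` are
zero or successors. -/
theorem omegaSet_mem (hM : IsElementarySubmodel M A) (h2 : omega2.{u} ∈ A) :
    omegaSet.{u} ∈ M := by
  have hA : omegaSet.{u} ∈ A := IsClosedClass.mem_of_subset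
    (fun _ hx => omega1_subset_omega2 (omegaSet_subset_omega1 hx)) h2
  refine hM.mem_of_unique (fun w => ∀ x ∈ A, x ∈ w ↔ x.IsOrdinal ∧
    ∀ y ∈ insert x x, y = ∅ ∨ ∃ z ∈ y, y = insert z z) ?_ hA (fun x _ => mem_omegaSet_iff)
    fun w hw h => ?_
  · exact .forall_mem (.iff (.mem' (.var 0) (.var 1)) (.and (.isOrdinal (.var 0))
      (.ball (P := fun y _ => y = ∅ ∨ ∃ z ∈ y, y = insert z z) (.succ (.var 0))
        (.or (.eq' (.var 0) .empty)
          (.bex (P := fun z v => v 0 = insert z z) (.var 0) (.eq' (.var 1) (.succ (.var 0))))))))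
  · ext x
    exact ⟨fun hx => mem_omegaSet_iff.2 ((h x (IsClosedClass.mem_of_mem hx hw)).1 hx),
      fun hx => (h x (IsClosedClass.mem_of_mem hx hA)).2 (mem_omegaSet_iff.1 hx)⟩

/-- The class `A` knows the order between the cardinalities of its elements. -/
theorem exists_app_surjection_iff {x y : ZFSet.{u}} (hx : x ∈ A) (hy : y ∈ A) :
    (∃ f ∈ A, ∀ b ∈ x, ∃ a ∈ y, app f a = b) ↔ x.card ≤ y.card := by
  classical
  rw [card_le_iff_exists_surjection]
  constructor
  · rintro ⟨f, -, hf⟩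
    refine ⟨fun a => if app f a ∈ x then app f a else ∅, fun a _ => ?_, fun b hb => ?_⟩
    · beta_reduce
      split_ifs with h
      · exact ZFSet.mem_insert_of_mem _ h
      · exact ZFSet.mem_insert _ _
    · obtain ⟨a, ha, rfl⟩ := hf b hb
      exact ⟨a, ha, if_pos hb⟩
  · rintro ⟨F, hF, hF'⟩
    refine ⟨graph y F, graph_mem_class hy fun a ha => ?_, fun b hb => ?_⟩
    · rcases ZFSet.mem_insert_iff.1 (hF a ha) with h | h
      · rw [h]; exact IsClosedClass.empty_mem
      · exact IsClosedClass.mem_of_mem h hx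
    · obtain ⟨a, ha, rfl⟩ := hF' b hb
      exact ⟨a, ha, app_graph ha⟩

/-- If `y ∈ M`, then `|y|⁺ ∈ M`: the elements of `|y|⁺` are the ordinals onto which there is a
surjection from `y`. -/
theorem succ_card_mem (hM : IsElementarySubmodel M A) {y z : ZFSet.{u}} (hy : y ∈ M) (hz : z ∈ A)
    (h : ∀ x, x ∈ z ↔ x.IsOrdinal ∧ x.card ≤ y.card) : z ∈ M := by
  have key := fun x (hx : x ∈ A) => exists_app_surjection_iff hx (hM.subset hy)
  refine hM.mem_of_unique (fun w => ∀ x ∈ A, x ∈ w ↔ x.IsOrdinal ∧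
    ∃ f ∈ A, ∀ b ∈ x, ∃ a ∈ y, app f a = b) ?_ hz (fun x hx => by rw [key x hx, h])
    fun w hw h' => ?_
  · exact .forall_mem (.iff (.mem' (.var 0) (.var 1)) (.and (.isOrdinal (.var 0))
      (.exists_mem (.ball (P := fun b v => ∃ a ∈ y, app (v 0) a = b) (.var 1)
        (.bex (P := fun a v => app (v 1) a = v 0) (.const hM hy)
          (.eq' (.app (.var 2) (.var 0)) (.var 1)))))))
  · ext x
    rw [h]
    constructor
    · intro hx
      have hxA := IsClosedClass.mem_of_mem hx hw
      rw [← key x hxA]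
      exact (h' x hxA).1 hx
    · intro hx
      have hxA := IsClosedClass.mem_of_mem ((h x).2 hx) hz
      rw [← key x hxA] at hx
      exact (h' x hxA).2 hx

theorem omega1_mem (hM : IsElementarySubmodel M A) (h2 : omega2.{u} ∈ A) : omega1.{u} ∈ M :=
  succ_card_mem hM (omegaSet_mem hM h2) (IsClosedClass.mem_of_subset omega1_subset_omega2 h2)
    fun _ => by rw [card_omegaSet, mem_omega1_iff]

theorem omega2_mem (hM : IsElementarySubmodel M A) (h2 : omega2.{u} ∈ A) : omega2.{u} ∈ M :=
  succ_card_mem hM (omega1_mem hM h2) h2 fun _ => by rw [card_omega1, mem_omega2_iff]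

theorem mem_of_mem_omegaSet (hM : IsElementarySubmodel M A) {n : ZFSet.{u}}
    (hn : n ∈ omegaSet.{u}) : n ∈ M := by
  obtain ⟨a, ha, rfl⟩ := Ordinal.mem_toZFSet_iff.1 hn
  obtain ⟨n, rfl⟩ := Ordinal.lt_omega0.1 ha
  clear ha hn
  induction n with
  | zero => simpa using hM.mem_of_defF .empty
  | succ n ih =>
    rw [Nat.cast_succ, Ordinal.toZFSet_add_one]
    exact hM.mem_of_defF (.succ (.const hM ih))

theorem mem_delta {a : ZFSet.{u}} : a ∈ delta M ↔ a ∈ omega1.{u} ∧ a ∈ M := ZFSet.mem_sep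

/-- `M ∩ ω₁` is a countable ordinal. -/
theorem delta_mem_omega1 (hM : IsElementarySubmodel M A) (h2 : omega2.{u} ∈ A)
    (hc : M.Countable) : delta M ∈ omega1.{u} := by
  have hω := omegaSet_mem hM h2
  refine mem_omega1_iff.2 ⟨?_, countable_iff_card_le.1 (hc.mono fun a ha => (mem_delta.1 ha).2)⟩
  refine ZFSet.isOrdinal_iff_forall_mem_isTransitive.2 ⟨fun a ha b hb => ?_,
    fun a ha => (isOrdinal_omega1.mem (mem_delta.1 ha).1).isTransitive⟩
  obtain ⟨ha1, haM⟩ := mem_delta.1 ha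
  refine mem_delta.2 ⟨isOrdinal_omega1.mem_trans hb ha1, ?_⟩
  have haA := hM.subset haM
  obtain ⟨f, hf, hf'⟩ := hM.exists_mem (Q := fun f => ∀ b ∈ a, ∃ n ∈ omegaSet, app f n = b)
    (.ball (P := fun b v => ∃ n ∈ omegaSet, app (v 0) n = b) (.const hM haM)
      (.bex (P := fun n v => app (v 1) n = v 0) (.const hM hω)
        (.eq' (.app (.var 2) (.var 0)) (.var 1))))
    ((exists_app_surjection_iff haA (hM.subset hω)).2
      ((mem_omega1_iff.1 ha1).2.trans card_omegaSet.ge))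
  obtain ⟨n, hn, rfl⟩ := hf' b hb
  exact hM.app_mem hf (mem_of_mem_omegaSet hM hn)

theorem funs_mem (hM : IsElementarySubmodel M A) {X Y : ZFSet.{u}} (hX : X ∈ M)
    (hY : Y ∈ M) (h : ZFSet.funs X Y ∈ A) : ZFSet.funs X Y ∈ M := by
  have key : ∀ f : ZFSet.{u}, ZFSet.IsFunc X Y f ↔ IsFunction f ∧
      (∀ p ∈ f, ∃ a ∈ X, ∃ b ∈ Y, p = ZFSet.pair a b) ∧ ∀ a ∈ X, ∃ b ∈ Y, ZFSet.pair a b ∈ f := by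
    intro f
    constructor
    · exact fun hf => ⟨hf.isFunction, fun p hp => ZFSet.mem_prod.1 (hf.1 hp),
        fun a ha => ⟨_, hf.app_mem ha, hf.pair_app_mem ha⟩⟩
    · rintro ⟨hf, h1, h2⟩
      refine ⟨fun p hp => ZFSet.mem_prod.2 (h1 p hp), fun a ha => ?_⟩
      obtain ⟨b, -, hb⟩ := h2 a ha
      exact ⟨b, hb, fun c hc => (isFunction_iff.1 hf).2 _ _ _ hc hb⟩
  refine hM.mem_of_unique (fun z => ∀ f ∈ A, f ∈ z ↔ IsFunction f ∧
      (∀ p ∈ f, ∃ a ∈ X, ∃ b ∈ Y, p = ZFSet.pair a b) ∧ ∀ a ∈ X, ∃ b ∈ Y, ZFSet.pair a b ∈ f)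
    ?_ h (fun f _ => by rw [← key, ZFSet.mem_funs]) fun z hz hzf => ?_
  · exact .forall_mem (.iff (.mem' (.var 0) (.var 1)) (.and (.isFunction (.var 0)) (.and
      (.ball (P := fun p _ => ∃ a ∈ X, ∃ b ∈ Y, p = ZFSet.pair a b) (.var 0)
        (.bex (P := fun a v => ∃ b ∈ Y, v 0 = ZFSet.pair a b) (.const hM hX)
          (.bex (P := fun b v => v 1 = ZFSet.pair (v 0) b) (.const hM hY)
            (.eq' (.var 2) (.pair (.var 1) (.var 0))))))
      (.ball (P := fun a v => ∃ b ∈ Y, ZFSet.pair a b ∈ v 0) (.const hM hX)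
        (.bex (P := fun b v => ZFSet.pair (v 0) b ∈ v 1) (.const hM hY)
          (.mem' (.pair (.var 1) (.var 0)) (.var 2)))))))
  · ext f
    rw [ZFSet.mem_funs, key]
    constructor
    · exact fun hf => (hzf f (IsClosedClass.mem_of_mem hf hz)).1 hf
    · intro hf
      exact (hzf f (IsClosedClass.mem_of_mem (ZFSet.mem_funs.2 ((key f).2 hf)) h)).2 hf

end Submodel

/-! ### Uniform enumerations and a ranking of the ordinals below `ω₂` -/

theorem exists_uncurry (G : ZFSet.{u} → ZFSet.{u} → ZFSet.{u}) :
    ∃ F : ZFSet.{u} → ZFSet.{u}, ∀ a b, F (ZFSet.pair a b) = G a b := by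
  classical
  refine ⟨fun p => if h : ∃ q : ZFSet.{u} × ZFSet.{u}, p = ZFSet.pair q.1 q.2 then
    G h.choose.1 h.choose.2 else ∅, fun a b => ?_⟩
  have h : ∃ q : ZFSet.{u} × ZFSet.{u}, ZFSet.pair a b = ZFSet.pair q.1 q.2 := ⟨(a, b), rfl⟩
  simp only [dif_pos h]
  obtain ⟨h1, h2⟩ := ZFSet.pair_inj.1 h.choose_spec
  rw [← h1, ← h2]

/-- If every element of `X` has size at most `|Y|`, then there is a function on `X × Y` whose
sections enumerate the elements of `X`. -/
theorem exists_enumeration [IsClosedClass A] (hM : IsElementarySubmodel M A) {X Y : ZFSet.{u}}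
    (hX : X ∈ M) (hY : Y ∈ M) (hord : X.IsOrdinal) (h0 : ∅ ∈ X)
    (hc : ∀ ξ ∈ X, ξ.card ≤ Y.card) :
    ∃ E ∈ M, ∀ ξ ∈ X, (∀ ν ∈ Y, app E (ZFSet.pair ξ ν) ∈ X) ∧
      ∀ η ∈ ξ, ∃ ν ∈ Y, app E (ZFSet.pair ξ ν) = η := by
  refine hM.exists_mem (Q := fun E => ∀ ξ ∈ X, (∀ ν ∈ Y, app E (ZFSet.pair ξ ν) ∈ X) ∧
      ∀ η ∈ ξ, ∃ ν ∈ Y, app E (ZFSet.pair ξ ν) = η)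
    (.ball (P := fun ξ v => (∀ ν ∈ Y, app (v 0) (ZFSet.pair ξ ν) ∈ X) ∧
      ∀ η ∈ ξ, ∃ ν ∈ Y, app (v 0) (ZFSet.pair ξ ν) = η) (.const hM hX) (.and
        (.ball (P := fun ν v => app (v 1) (ZFSet.pair (v 0) ν) ∈ X) (.const hM hY)
          (.mem' (.app (.var 2) (.pair (.var 1) (.var 0))) (.const hM hX)))
        (.ball (P := fun η v => ∃ ν ∈ Y, app (v 1) (ZFSet.pair (v 0) ν) = η) (.var 0)
          (.bex (P := fun ν v => app (v 2) (ZFSet.pair (v 1) ν) = v 0) (.const hM hY)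
            (.eq' (.app (.var 3) (.pair (.var 2) (.var 0))) (.var 1)))))) ?_
  choose! G hG hG' using fun ξ hξ => card_le_iff_exists_surjection.1 (hc ξ hξ)
  have hGX : ∀ ξ ∈ X, ∀ ν ∈ Y, G ξ ν ∈ X := fun ξ hξ ν hν => by
    rcases ZFSet.mem_insert_iff.1 (hG ξ hξ ν hν) with h | h
    · rwa [h]
    · exact hord.mem_trans h hξ
  obtain ⟨F, hF⟩ := exists_uncurry G
  have happ : ∀ ξ ∈ X, ∀ ν ∈ Y, app (graph (ZFSet.prod X Y) F) (ZFSet.pair ξ ν) = G ξ ν :=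
    fun ξ hξ ν hν => by rw [app_graph (ZFSet.pair_mem_prod.2 ⟨hξ, hν⟩), hF]
  refine ⟨graph (ZFSet.prod X Y) F, graph_mem_class
    (prod_mem_class (hM.subset hX) (hM.subset hY)) fun p hp => ?_, fun ξ hξ => ⟨fun ν hν => ?_,
      fun η hη => ?_⟩⟩
  · obtain ⟨ξ, hξ, ν, hν, rfl⟩ := ZFSet.mem_prod.1 hp
    rw [hF]
    exact IsClosedClass.mem_of_mem (hGX ξ hξ ν hν) (hM.subset hX)
  · rw [happ ξ hξ ν hν]
    exact hGX ξ hξ ν hν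
  · obtain ⟨ν, hν, h⟩ := hG' ξ hξ η hη
    exact ⟨ν, hν, (happ ξ hξ ν hν).trans h⟩

/-- The rank of `ξ` with respect to the relation which connects `e ξ ν` to `ξ` if `ν ∈ β` and
`e ξ ν ∈ ξ`. If `e ξ` enumerates the ordinal `ξ < ω₂`, then `β ↦ localRank e β ξ` is a variant of
the canonical function of `ξ`. -/
noncomputable def localRank (e : ZFSet.{u} → ZFSet.{u} → ZFSet.{u}) (β ξ : ZFSet.{u}) :
    ZFSet.{u} :=
  open Classical in
  ZFSet.iUnion fun ν : β =>
    if _ : e ξ ν ∈ ξ then insert (localRank e β (e ξ ν)) (localRank e β (e ξ ν)) else ∅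
termination_by ξ

theorem mem_localRank {e : ZFSet.{u} → ZFSet.{u} → ZFSet.{u}} {β ξ x : ZFSet.{u}} :
    x ∈ localRank e β ξ ↔ ∃ ν ∈ β, e ξ ν ∈ ξ ∧
      x ∈ insert (localRank e β (e ξ ν)) (localRank e β (e ξ ν)) := by
  rw [localRank, ZFSet.mem_iUnion]
  constructor
  · rintro ⟨ν, hν⟩
    split_ifs at hν with h
    · exact ⟨ν, ν.2, h, hν⟩
    · exact (ZFSet.notMem_empty _ hν).elim
  · rintro ⟨ν, hν, h, hx⟩
    exact ⟨⟨ν, hν⟩, by rwa [dif_pos h]⟩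

theorem localRank_mem_omega1 (e : ZFSet.{u} → ZFSet.{u} → ZFSet.{u}) {β : ZFSet.{u}}
    (hβ : β ∈ omega1.{u}) (ξ : ZFSet.{u}) : localRank e β ξ ∈ omega1.{u} := by
  induction ξ using ZFSet.inductionOn with
  | h ξ ih =>
    have hs : ∀ ν, e ξ ν ∈ ξ →
        insert (localRank e β (e ξ ν)) (localRank e β (e ξ ν)) ∈ omega1.{u} :=
      fun ν h => succ_mem_omega1 (ih _ h)
    refine mem_omega1_iff.2 ⟨ZFSet.isOrdinal_iff_forall_mem_isTransitive.2
      ⟨fun x hx y hy => ?_, fun x hx => ?_⟩, countable_iff_card_le.1 ?_⟩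
    · obtain ⟨ν, hν, h, hx⟩ := mem_localRank.1 hx
      exact mem_localRank.2 ⟨ν, hν, h, (mem_omega1_iff.1 (hs ν h)).1.mem_trans hy hx⟩
    · obtain ⟨ν, hν, h, hx⟩ := mem_localRank.1 hx
      exact ((mem_omega1_iff.1 (hs ν h)).1.mem hx).isTransitive
    · have : (⋃ ν ∈ {ν | ν ∈ β ∧ e ξ ν ∈ ξ}, {x | x ∈ insert (localRank e β (e ξ ν))
          (localRank e β (e ξ ν))}).Countable :=
        ((countable_iff_card_le.2 (mem_omega1_iff.1 hβ).2).mono fun _ h => h.1).biUnion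
          fun ν h => countable_iff_card_le.2 (mem_omega1_iff.1 (hs ν h.2)).2
      refine this.mono fun x hx => ?_
      obtain ⟨ν, hν, h, hx⟩ := mem_localRank.1 hx
      exact Set.mem_iUnion₂.2 ⟨ν, ⟨hν, h⟩, hx⟩

/-- The model `M` contains a family `c` of functions `c_ξ : ω₁ → ω₁`, for `ξ < ω₂`, such that
`c_η(β) < c_ξ(β)` whenever `η < ξ` is listed below `β` in the enumeration `E_ξ` of `ξ`. -/
theorem exists_ranking [IsClosedClass A] (hM : IsElementarySubmodel M A) (h2 : omega2.{u} ∈ A)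
    {E : ZFSet.{u}} (hE : E ∈ M) :
    ∃ c ∈ M, ∀ ξ ∈ omega2, ∀ β ∈ omega1, app c (ZFSet.pair ξ β) ∈ omega1.{u} ∧
      ∀ ν ∈ β, app E (ZFSet.pair ξ ν) ∈ ξ →
        app c (ZFSet.pair (app E (ZFSet.pair ξ ν)) β) ∈ app c (ZFSet.pair ξ β) := by
  have hω1 := omega1_mem hM h2
  have hω2 := omega2_mem hM h2
  refine hM.exists_mem (Q := fun c => ∀ ξ ∈ omega2, ∀ β ∈ omega1,
      app c (ZFSet.pair ξ β) ∈ omega1.{u} ∧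
      ∀ ν ∈ β, app E (ZFSet.pair ξ ν) ∈ ξ →
        app c (ZFSet.pair (app E (ZFSet.pair ξ ν)) β) ∈ app c (ZFSet.pair ξ β))
    (.ball (P := fun ξ v => ∀ β ∈ omega1, app (v 0) (ZFSet.pair ξ β) ∈ omega1.{u} ∧
      ∀ ν ∈ β, app E (ZFSet.pair ξ ν) ∈ ξ →
        app (v 0) (ZFSet.pair (app E (ZFSet.pair ξ ν)) β) ∈ app (v 0) (ZFSet.pair ξ β))
      (.const hM hω2)
      (.ball (P := fun β v => app (v 1) (ZFSet.pair (v 0) β) ∈ omega1.{u} ∧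
        ∀ ν ∈ β, app E (ZFSet.pair (v 0) ν) ∈ v 0 →
          app (v 1) (ZFSet.pair (app E (ZFSet.pair (v 0) ν)) β) ∈
            app (v 1) (ZFSet.pair (v 0) β))
        (.const hM hω1) (.and
          (.mem' (.app (.var 2) (.pair (.var 1) (.var 0))) (.const hM hω1))
          (.ball (P := fun ν v => app E (ZFSet.pair (v 1) ν) ∈ v 1 →
            app (v 2) (ZFSet.pair (app E (ZFSet.pair (v 1) ν)) (v 0)) ∈
              app (v 2) (ZFSet.pair (v 1) (v 0))) (.var 0)
            (.imp (.mem' (.app (.const hM hE) (.pair (.var 2) (.var 0))) (.var 2))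
              (.mem' (.app (.var 3) (.pair (.app (.const hM hE) (.pair (.var 2) (.var 0)))
                (.var 1))) (.app (.var 3) (.pair (.var 2) (.var 1))))))))) ?_
  let e : ZFSet.{u} → ZFSet.{u} → ZFSet.{u} := fun ξ ν => app E (ZFSet.pair ξ ν)
  obtain ⟨F, hF⟩ := exists_uncurry fun ξ β => localRank e β ξ
  have happ : ∀ ξ ∈ omega2.{u}, ∀ β ∈ omega1.{u},
      app (graph (ZFSet.prod omega2 omega1) F) (ZFSet.pair ξ β) = localRank e β ξ :=
    fun ξ hξ β hβ => by rw [app_graph (ZFSet.pair_mem_prod.2 ⟨hξ, hβ⟩), hF]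
  refine ⟨graph (ZFSet.prod omega2 omega1) F, graph_mem_class
    (prod_mem_class h2 (hM.subset hω1)) fun p hp => ?_, fun ξ hξ β hβ => ⟨?_, fun ν hν h => ?_⟩⟩
  · obtain ⟨ξ, hξ, β, hβ, rfl⟩ := ZFSet.mem_prod.1 hp
    rw [hF]
    exact IsClosedClass.mem_of_mem (localRank_mem_omega1 e hβ ξ) (hM.subset hω1)
  · rw [happ ξ hξ β hβ]
    exact localRank_mem_omega1 e hβ ξ
  · rw [happ ξ hξ β hβ, happ _ (isOrdinal_omega2.mem_trans h hξ) β hβ]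
    exact mem_localRank.2 ⟨ν, hν, h, ZFSet.mem_insert _ _⟩

/-! ### Extensions of models which do not add countable ordinals -/

/-- `N` is a countable elementary submodel of `A` which extends `M` and has the same countable
ordinals as `M`. -/
structure IsDeltaExtension (A M N : Set ZFSet.{u}) : Prop where
  countable : N.Countable
  elementary : IsElementarySubmodel N A
  subset : M ⊆ N
  delta_eq : delta N = delta M

/-- The instance of the cof-Strong Chang's Conjecture for submodels of `A`. -/
def SCCcofFor (A : Set ZFSet.{u}) : Prop :=
  ∀ M : Set ZFSet.{u}, M.Countable → IsElementarySubmodel M A →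
    ∀ η ∈ omega2.{u}, ∃ ξ ∈ omega2.{u}, η ⊆ ξ ∧ Parallel ξ M

theorem IsDeltaExtension.trans {K : Set ZFSet.{u}} (h : IsDeltaExtension A M N)
    (h' : IsDeltaExtension A N K) : IsDeltaExtension A M K :=
  ⟨h'.countable, h'.elementary, h.subset.trans h'.subset, h'.delta_eq.trans h.delta_eq⟩

theorem IsDeltaExtension.refl (hc : M.Countable) (hM : IsElementarySubmodel M A) :
    IsDeltaExtension A M M := ⟨hc, hM, subset_rfl, rfl⟩

theorem IsDeltaExtension.iUnion {N : ℕ → Set ZFSet.{u}} (hN : Monotone N)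
    (h : ∀ k, IsDeltaExtension A M (N k)) : IsDeltaExtension A M (⋃ k, N k) where
  countable := Set.countable_iUnion fun k => (h k).countable
  elementary := iUnion_isElementarySubmodel hN fun k => (h k).elementary
  subset := (h 0).subset.trans (Set.subset_iUnion N 0)
  delta_eq := by
    ext a
    rw [mem_delta, Set.mem_iUnion]
    constructor
    · rintro ⟨ha, k, hk⟩
      rw [← (h k).delta_eq]
      exact mem_delta.2 ⟨ha, hk⟩
    · intro ha
      rw [← (h 0).delta_eq] at ha
      exact ⟨(mem_delta.1 ha).1, 0, (mem_delta.1 ha).2⟩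

theorem IsDeltaExtension.hull [IsClosedClass A] {X x : ZFSet.{u}} (hc : M.Countable)
    (hM : IsElementarySubmodel M A) (hX : X ∈ M) (hx : x ∈ X) (h : Parallel x M) :
    IsDeltaExtension A M (Hull M x) :=
  ⟨hull_countable hc x, hull_isElementarySubmodel hM hX hx, subset_hull hM hX hx, h⟩

section Capture

variable [IsClosedClass A]

/-- Some extension contains an ordinal `ξ < ω₂` above all ordinals below `ω₂` in `M`, and above a
given `η < ω₂`. -/
theorem SCCcofFor.exists_extension (hS : SCCcofFor A) (h2 : omega2.{u} ∈ A) (hc : M.Countable)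
    (hM : IsElementarySubmodel M A) {η : ZFSet.{u}} (hη : η ∈ omega2.{u}) :
    ∃ N, IsDeltaExtension A M N ∧ ∃ ξ ∈ N, ξ ∈ omega2.{u} ∧ η ∈ ξ ∧
      ∀ ζ ∈ M, ζ ∈ omega2.{u} → ζ ∈ ξ := by
  obtain ⟨η', hη', h⟩ := exists_bound_of_card_le (S := insert η {ζ | ζ ∈ M ∧ ζ ∈ omega2.{u}})
    (by rintro x (rfl | hx); exacts [hη, hx.2])
    ((le_aleph0_iff_set_countable.2 ((hc.mono fun _ h => h.1).insert η)).trans (aleph0_le_aleph 1))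
  obtain ⟨ξ, hξ, hle, hpar⟩ := hS M hc hM η' hη'
  have hω2 := omega2_mem hM h2
  exact ⟨Hull M ξ, .hull hc hM hω2 hξ hpar, ξ, mem_hull_self hM hω2 hξ, hξ,
    hle (h η (Set.mem_insert _ _)), fun ζ hζ hζ2 => hle (h ζ (Set.mem_insert_of_mem _ ⟨hζ, hζ2⟩))⟩

/-- By recursion on `α < ω₁`, the model `M` is extended to a model with an ordinal `ξ < ω₂` for
which `c_ξ(δ) ≥ α`: if `N` contains such ordinals for all smaller `α' < α`, then any `ξ` above
`N ∩ ω₂` works for `α`, since all elements of `ξ` in the extension are listed below `δ`. -/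
theorem SCCcofFor.exists_large_rank (hS : SCCcofFor A) (h2 : omega2.{u} ∈ A)
    {E c : ZFSet.{u}}
    (hE : ∀ ξ ∈ omega2.{u}, ∀ η ∈ ξ, ∃ ν ∈ omega1.{u}, app E (ZFSet.pair ξ ν) = η)
    (hcr : ∀ ξ ∈ omega2, ∀ β ∈ omega1, app c (ZFSet.pair ξ β) ∈ omega1.{u} ∧
      ∀ ν ∈ β, app E (ZFSet.pair ξ ν) ∈ ξ →
        app c (ZFSet.pair (app E (ZFSet.pair ξ ν)) β) ∈ app c (ZFSet.pair ξ β))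
    (α : ZFSet.{u}) : ∀ M : Set ZFSet.{u}, M.Countable → IsElementarySubmodel M A → E ∈ M →
      α ∈ omega1.{u} → ∃ N, IsDeltaExtension A M N ∧ ∃ ξ ∈ N, ξ ∈ omega2.{u} ∧
        α ⊆ app c (ZFSet.pair ξ (delta M)) := by
  induction α using ZFSet.inductionOn with
  | h α ih =>
    intro M hc hM hEM hα
    have h02 : ∅ ∈ omega2.{u} := mem_omega2_iff.2 ⟨ZFSet.isOrdinal_empty, by simp⟩
    obtain ⟨N, hN, hNα⟩ : ∃ N, IsDeltaExtension A M N ∧ ∀ β ∈ α, ∃ ξ ∈ N, ξ ∈ omega2.{u} ∧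
        β ⊆ app c (ZFSet.pair ξ (delta M)) := by
      rcases {β | β ∈ α}.eq_empty_or_nonempty with h | hne
      · exact ⟨M, .refl hc hM, fun β hβ => (h.subset hβ).elim⟩
      obtain ⟨a, ha⟩ := (countable_iff_card_le.2 (mem_omega1_iff.1 hα).2).exists_eq_range hne
      have haα : ∀ n, a n ∈ α := fun n => ha.superset ⟨n, rfl⟩
      have hstep : ∀ (n : ℕ) (N : {N // IsDeltaExtension A M N}),
          ∃ N' : {N // IsDeltaExtension A M N}, N.1 ⊆ N'.1 ∧ ∃ ξ ∈ N'.1, ξ ∈ omega2.{u} ∧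
            a n ⊆ app c (ZFSet.pair ξ (delta M)) := by
        rintro n ⟨N, hN⟩
        obtain ⟨N', hN', hξ⟩ := ih (a n) (haα n) N hN.countable hN.elementary (hN.subset hEM)
          (isOrdinal_omega1.mem_trans (haα n) hα)
        rw [hN.delta_eq] at hξ
        exact ⟨⟨N', hN.trans hN'⟩, hN'.subset, hξ⟩
      choose next hnext hnext' using hstep
      let K : ℕ → {N // IsDeltaExtension A M N} := fun n =>
        Nat.rec ⟨M, .refl hc hM⟩ (fun n N => next n N) n
      refine ⟨⋃ n, (K n).1, .iUnion (monotone_nat_of_le_succ fun n => hnext n (K n))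
        fun n => (K n).2, fun β hβ => ?_⟩
      obtain ⟨n, rfl⟩ := ha.subset hβ
      obtain ⟨ξ, hξ, h⟩ := hnext' n (K n)
      exact ⟨ξ, Set.mem_iUnion.2 ⟨n + 1, hξ⟩, h⟩
    obtain ⟨N', hN', ξ, hξN, hξ, -, hbound⟩ :=
      hS.exists_extension h2 hN.countable hN.elementary h02
    have hMN' := hN.trans hN'
    refine ⟨N', hMN', ξ, hξN, hξ, fun β hβ => ?_⟩
    obtain ⟨ζ, hζN, hζ, hβζ⟩ := hNα β hβ
    have hδ := delta_mem_omega1 hM h2 hc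
    have hζξ := hbound ζ hζN hζ
    -- By elementarity, `ζ` is listed in the enumeration of `ξ` at an index in `N'`, that is,
    -- below `δ`.
    obtain ⟨ν, hνN, hν, hEν⟩ := hN'.elementary.exists_mem
      (Q := fun ν => ν ∈ omega1 ∧ app E (ZFSet.pair ξ ν) = ζ)
      (.and (.mem' (.var 0) (.const hN'.elementary (omega1_mem hN'.elementary h2)))
        (.eq' (.app (.const hN'.elementary (hMN'.subset hEM))
          (.pair (.const hN'.elementary hξN) (.var 0)))
          (.const hN'.elementary (hN'.subset hζN))))
      (by
        obtain ⟨ν, hν, h⟩ := hE ξ hξ ζ hζξ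
        exact ⟨ν, IsClosedClass.mem_of_mem (omega1_subset_omega2 hν) h2, hν, h⟩)
    have hνδ : ν ∈ delta M := hMN'.delta_eq ▸ mem_delta.2 ⟨hν, hνN⟩
    have hlt := (hcr ξ hξ _ hδ).2 ν hνδ (hEν ▸ hζξ)
    rw [hEν] at hlt
    exact (isOrdinal_omega1.mem (isOrdinal_omega1.mem_trans hβ hα)).mem_of_subset_of_mem
      (isOrdinal_omega1.mem (hcr ξ hξ _ hδ).1) hβζ hlt

/-- Every challenge can be answered in the capturing game. -/
theorem SCCcofFor.exists_answer (hS : SCCcofFor A) (h2 : omega2.{u} ∈ A)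
    (hfuns : ZFSet.funs omega1.{u} omega2 ∈ M) (hc : M.Countable)
    (hM : IsElementarySubmodel M A) {x : ZFSet.{u}} (hx : x ∈ omega2.{u}) :
    ∃ f, ZFSet.IsFunc omega1 omega2 f ∧ ZFSet.pair (delta M) x ∈ f ∧ Parallel f M := by
  have hω := omegaSet_mem hM h2
  have hω1 := omega1_mem hM h2
  have hω2 := omega2_mem hM h2
  have h01 : ∅ ∈ omega1.{u} := mem_omega1_iff.2 ⟨ZFSet.isOrdinal_empty, by simp⟩
  obtain ⟨E, hEM, hE⟩ := exists_enumeration hM hω2 hω1 isOrdinal_omega2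
    (omega1_subset_omega2 h01) fun ξ hξ => (mem_omega2_iff.1 hξ).2.trans card_omega1.ge
  obtain ⟨D, hDM, hD⟩ := exists_enumeration hM hω1 hω isOrdinal_omega1 h01
    fun ξ hξ => (mem_omega1_iff.1 hξ).2.trans card_omegaSet.ge
  obtain ⟨c, hcM, hcr⟩ := exists_ranking hM h2 hEM
  have hδ := delta_mem_omega1 hM h2 hc
  -- `x = E_{ξ₀}(α)`, and `α = D_γ(n)`, where `γ = c_ξ(δ)`
  obtain ⟨N₁, hN₁, ξ₀, hξ₀N, hξ₀, hxξ₀, -⟩ := hS.exists_extension h2 hc hM hx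
  obtain ⟨α, hα, hEα⟩ := (hE ξ₀ hξ₀).2 x hxξ₀
  obtain ⟨N₂, hN₂, ξ, hξN, hξ, hαξ⟩ := hS.exists_large_rank h2 (fun ξ hξ => (hE ξ hξ).2) hcr
    (insert α α) N₁ hN₁.countable hN₁.elementary (hN₁.subset hEM) (succ_mem_omega1 hα)
  rw [hN₁.delta_eq] at hαξ
  obtain ⟨n, hn, hDn⟩ := (hD _ (hcr ξ hξ _ hδ).1).2 α (hαξ (ZFSet.mem_insert _ _))
  have hN := hN₁.trans hN₂
  have hNe := hN.elementary
  have hval : ∀ β ∈ omega1.{u}, app E (ZFSet.pair ξ₀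
      (app D (ZFSet.pair (app c (ZFSet.pair ξ β)) n))) ∈ omega2.{u} := fun β hβ =>
    (hE ξ₀ hξ₀).1 _ ((hD _ (hcr ξ hξ β hβ).1).1 n hn)
  obtain ⟨f, hfN, hf, hfval⟩ := hNe.exists_mem
    (Q := fun f => f ∈ ZFSet.funs omega1.{u} omega2 ∧ ∀ β ∈ omega1.{u}, app f β =
      app E (ZFSet.pair ξ₀ (app D (ZFSet.pair (app c (ZFSet.pair ξ β)) n))))
    (.and (.mem' (.var 0) (.const hNe (hN.subset hfuns)))
      (.ball (P := fun β v => app (v 0) β =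
        app E (ZFSet.pair ξ₀ (app D (ZFSet.pair (app c (ZFSet.pair ξ β)) n))))
        (.const hNe (hN.subset hω1))
        (.eq' (.app (.var 1) (.var 0)) (.app (.const hNe (hN.subset hEM))
          (.pair (.const hNe (hN₂.subset hξ₀N)) (.app (.const hNe (hN.subset hDM))
            (.pair (.app (.const hNe (hN.subset hcM)) (.pair (.const hNe hξN) (.var 0)))
              (.const hNe (mem_of_mem_omegaSet hNe hn)))))))))
    (by
      have h := isFunc_graph hval
      exact ⟨_, IsClosedClass.mem_of_mem (ZFSet.mem_funs.2 h) (hM.subset hfuns),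
        ZFSet.mem_funs.2 h, fun β hβ => app_graph hβ⟩)
  have hf' := ZFSet.mem_funs.1 hf
  refine ⟨f, hf', ?_, parallel_of_mem hM hNe hN.subset hN.delta_eq hfuns hf hfN⟩
  have := hf'.pair_app_mem hδ
  rwa [hfval _ hδ, hDn, hEα] at this

end Capture

/-! ### The capturing game -/

/-- The model reached from `M` after the finitely many rounds listed in `l`. -/
def modelOfList (M : Set ZFSet.{u}) (l : List (ZFSet.{u} × ZFSet.{u})) : Set ZFSet.{u} :=
  l.foldl (fun N p => Hull N p.2) M

theorem modelOfList_ofFn (M : Set ZFSet.{u}) (x f : ℕ → ZFSet.{u}) (n : ℕ) :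
    modelOfList M (List.ofFn fun i : Fin n => (x i, f i)) = model M f n := by
  induction n with
  | zero => simp [modelOfList, model]
  | succ n ih =>
    rw [List.ofFn_succ', modelOfList, List.concat_eq_append, List.foldl_append]
    simp only [List.foldl_cons, List.foldl_nil, Fin.val_last, Fin.val_castSucc]
    rw [model, ← ih]
    rfl

/-- The second player wins by always answering such that the next model has the same countable
ordinals. -/
theorem SCCcofFor.p2HasWinningStrategy [IsClosedClass A] (hS : SCCcofFor A)
    (h2 : omega2.{u} ∈ A) (hfuns : ZFSet.funs omega1.{u} omega2 ∈ A) (hc : M.Countable)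
    (hM : IsElementarySubmodel M A) : P2HasWinningStrategy M omega2.{u} := by
  classical
  have hfunsM := funs_mem hM (omega1_mem hM h2) (omega2_mem hM h2) hfuns
  let good : Set ZFSet.{u} → ZFSet.{u} → ZFSet.{u} → Prop := fun N x f =>
    ZFSet.IsFunc omega1 omega2 f ∧ ZFSet.pair (delta N) x ∈ f ∧ Parallel f N
  refine ⟨fun l x => if h : ∃ f, good (modelOfList M l) x f then h.choose else ∅,
    fun x f hf n hn => ?_⟩
  by_contra! hx
  refine hn ?_
  have hanswer : ∀ k ≤ n, IsDeltaExtension A M (model M f k) → ObeysP2 M omega2 x f k := by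
    intro k hk hext
    have hex : ∃ g, good (model M f k) (x k) g :=
      hS.exists_answer h2 (hext.subset hfunsM) hext.countable hext.elementary (hx k hk)
    have hfk := hf k
    beta_reduce at hfk
    rw [modelOfList_ofFn, dif_pos hex] at hfk
    rw [ObeysP2, hfk]
    exact hex.choose_spec
  have hext : ∀ k ≤ n, IsDeltaExtension A M (model M f k) := by
    intro k
    induction k with
    | zero => exact fun _ => .refl hc hM
    | succ k ih =>
      intro hk
      have hk' := ih (by omega)
      obtain ⟨h1, -, h3⟩ := hanswer k (by omega) hk'
      exact hk'.trans (.hull hk'.countable hk'.elementary (hk'.subset hfunsM)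
        (ZFSet.mem_funs.2 h1) h3)
  exact hanswer n le_rfl (hext n le_rfl)

/-- The answers given by the strategy `σ` to the challenges `x 0, x 1, …`. -/
noncomputable def answers (σ : StrategyP2.{u}) (x : ℕ → ZFSet.{u}) (n : ℕ) : ZFSet.{u} :=
  σ (List.ofFn fun i : Fin n => (x i, answers σ x i)) (x n)
termination_by n
decreasing_by exact i.2

theorem follows_answers (σ : StrategyP2.{u}) (x : ℕ → ZFSet.{u}) : Follows σ x (answers σ x) :=
  fun n => by rw [answers]

/-- The range of the answer `f` to the challenge `η` is bounded by some `ξ < ω₂` in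
`Hull(M, f)`. -/
theorem exists_parallel_of_winningStrategy [IsClosedClass A] (h2 : omega2.{u} ∈ A)
    (hfuns : ZFSet.funs omega1.{u} omega2 ∈ A) (hc : M.Countable)
    (hM : IsElementarySubmodel M A) (hw : P2HasWinningStrategy M omega2.{u})
    {η : ZFSet.{u}} (hη : η ∈ omega2.{u}) : ∃ ξ ∈ omega2.{u}, η ⊆ ξ ∧ Parallel ξ M := by
  have hω1 := omega1_mem hM h2
  have hω2 := omega2_mem hM h2
  have hfunsM := funs_mem hM hω1 hω2 hfuns
  obtain ⟨σ, hσ⟩ := hw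
  obtain ⟨f, hf⟩ : ∃ f, Follows σ (fun _ => η) f := ⟨_, follows_answers σ _⟩
  have hobey : ObeysP2 M omega2 (fun _ => η) f 0 := by
    by_contra h
    obtain ⟨m, -, hm⟩ := hσ _ f hf 0 h
    exact hm hη
  obtain ⟨hf0, hpair, hpar⟩ := hobey
  change ZFSet.pair (delta M) η ∈ f 0 at hpair
  change Parallel (f 0) M at hpar
  have hf0' := ZFSet.mem_funs.2 hf0
  have hN := IsDeltaExtension.hull hc hM hfunsM hf0' hpar
  have hfN := mem_hull_self hM hfunsM hf0'
  obtain ⟨ξ, hξN, hξ, hbound⟩ := hN.elementary.exists_mem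
    (Q := fun ξ => ξ ∈ omega2 ∧ ∀ β ∈ omega1, app (f 0) β ∈ ξ)
    (.and (.mem' (.var 0) (.const hN.elementary (hN.subset hω2)))
      (.ball (P := fun β v => app (f 0) β ∈ v 0) (.const hN.elementary (hN.subset hω1))
        (.mem' (.app (.const hN.elementary hfN) (.var 0)) (.var 1))))
    (by
      obtain ⟨ξ, hξ, h⟩ := exists_bound_of_card_le (S := app (f 0) '' {β | β ∈ omega1.{u}})
        (by rintro _ ⟨β, hβ, rfl⟩; exact hf0.app_mem hβ) (by
          refine Cardinal.mk_image_le.trans (ZFSet.cardinalMk_coe_sort (x := omega1.{u})).le |>.trans ?_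
          rw [card_omega1, Cardinal.lift_aleph, Ordinal.lift_one])
      exact ⟨ξ, IsClosedClass.mem_of_mem hξ h2, hξ, fun β hβ => h _ ⟨β, hβ, rfl⟩⟩)
  refine ⟨ξ, hξ, ?_, parallel_of_mem hM hN.elementary hN.subset hN.delta_eq hω2 hξ hξN⟩
  have := hbound _ (delta_mem_omega1 hM h2 hc)
  rw [hf0.isFunction.app_eq hpair] at this
  exact (isOrdinal_omega2.mem hξ).subset_of_mem this

end CapturingGame

theorem mainTheorem9 :
    CapturingGame.SCCcof.{u} ↔
      ∀ θ : Cardinal.{u}, θ.IsRegular → CapturingGame.MuchLess CapturingGame.omega2.{u} θ →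
        ∀ M : Set ZFSet.{u}, M.Countable →
          CapturingGame.IsElementarySubmodel M (CapturingGame.H θ) →
            CapturingGame.P2HasWinningStrategy M CapturingGame.omega2.{u} := by
  constructor
  · intro h θ hθ hlt M hc hM
    have := CapturingGame.isClosedClass_H hθ
    exact CapturingGame.SCCcofFor.p2HasWinningStrategy (h θ hθ hlt)
      (CapturingGame.omega2_mem_H hθ hlt) (CapturingGame.funs_mem_H hθ hlt) hc hM
  · intro h θ hθ hlt M hc hM η hη
    have := CapturingGame.isClosedClass_H hθ
    exact CapturingGame.exists_parallel_of_winningStrategy (CapturingGame.omega2_mem_H hθ hlt)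
      (CapturingGame.funs_mem_H hθ hlt) hc hM (h θ hθ hlt M hc hM) hη
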